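/- Let $R^4_2$ be $\mathbb R^4$ with the scalar product $\langle x,y\rangle = x_1y_1+x_2y_2-x_3y_3-x_4y_4$, let $H^3_1(1)=\{x\in R^4_2:\langle x,x\rangle=-1\}$ be the 3-dimensional anti-de Sitter space with the induced Lorentzian metric, and let $H^2(r)=\{y\in\mathbb R^3: y_1^2+y_2^2-y_3^2=-r^2,\ y_3>0\}$ be the hyperbolic plane of radius $r>0$, with the metric induced from $dy_1^2+dy_2^2-dy_3^2$. For a smooth space-like immersion $\varphi:M\to H^3_1(1)$ of a surface, with $M$ carrying the induced Riemannian metric, let $\tau(\varphi)=\operatorname{trace}\nabla d\varphi$ be its tension field and $$\tau_2(\varphi)=\operatorname{trace}\nabla^2\tau(\varphi)-\operatorname{trace}R(d\varphi,\tau(\varphi))d\varphi$$ its second tension field, where $\nabla$ is induced by the Levi-Civita connections and $R(X,Y)=[\nabla_X,\nabla_Y]-\nabla_{[X,Y]}$ is the curvature tensor of $H^3_1(1)$. Call $\varphi$ biharmonic if $\tau_2(\varphi)\equiv 0$, maximal if $\tau(\varphi)\equiv 0$, and proper biharmonic if it is biharmonic and not maximal. **Theorem.** Let $M$ be a connected (Hausdorff)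 smooth surface without boundary and $\varphi:M\to H^3_1(1)$ a proper biharmonic smooth space-like immersion. Then, up to an isometry of $H^3_1(1)$, $M$ is an open part of the naturally embedded totally umbilical hyperbolic plane $H^2(1/\sqrt2)$, and it is the whole of it if $M$ is complete. Precisely: there are a linear isometry $T$ of $R^4_2$ and a map $F:M\to H^2(1/\sqrt2)$ with $$T(\varphi(p))=\bigl(F(p),\,1/\sqrt2\bigr)\quad\text{for all } p\in M,$$ so that $T\circ\varphi$ takes values in the slice $x_4=1/\sqrt2$, and $F$ is a local homeomorphism (hence, by this formula, a local isometry); if the induced metric on $M$ is complete, then $F$ is a homeomorphism (hence an isometry) of $M$ onto $H^2(1/\sqrt2)$. -/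

import Mathlib

open Set Filter Topology Manifold
open scoped ContDiff ENNReal

noncomputable section

namespace AntiDeSitter

/-! ### The ambient spaces -/

/-- The indefinite scalar product `x₁y₁ + x₂y₂ - x₃y₃ - x₄y₄` of the pseudo-Euclidean space
`R⁴₂`. -/
def ip (x y : Fin 4 → ℝ) : ℝ := x 0 * y 0 + x 1 * y 1 - x 2 * y 2 - x 3 * y 3

/-- The anti-de Sitter space `H³₁(1) = {x ∈ R⁴₂ : ⟨x, x⟩ = -1}`. Its tangent space at `x` is
`{v : ⟨v, x⟩ = 0}` and its metric is the restriction of `ip`. -/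
def adS : Set (Fin 4 → ℝ) := {x | ip x x = -1}

/-- The hyperbolic plane `H²(r)`: the component through `(0, 0, r)` of
`{y ∈ R³₁ : y₁² + y₂² - y₃² = -r²}`. -/
def hyperbolicPlane (r : ℝ) : Set (Fin 3 → ℝ) :=
  {y | y 0 ^ 2 + y 1 ^ 2 - y 2 ^ 2 = -r ^ 2 ∧ 0 < y 2}

/-- The natural embedding of `R³₁` in `R⁴₂` as the slice `x₄ = s`. It preserves the scalar products
of tangent vectors, and it maps `H²(r)` into `H³₁(1)` if `r ^ 2 + s ^ 2 = 1`. -/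
def slice (s : ℝ) (y : Fin 3 → ℝ) : Fin 4 → ℝ := ![y 0, y 1, y 2, s]

/-- The Riemann curvature tensor of `H³₁(1)`, a space of constant curvature `-1`, with the sign
convention `R(X, Y) = [∇_X, ∇_Y] - ∇_[X, Y]`
(see `covDeriv_covDeriv_sub` for its relation to the Levi-Civita connection). -/
def curv (a b v : Fin 4 → ℝ) : Fin 4 → ℝ := -(ip b v • a - ip a v • b)

/-! ### Local calculus along a parametrized surface `u : ℝ² → H³₁(1)` -/

/-- The partial derivative with respect to the `i`-th coordinate of `ℝ²`. -/
def pd {F : Type*} [NormedAddCommGroup F] [NormedSpace ℝ F] (i : Fin 2)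
    (f : EuclideanSpace ℝ (Fin 2) → F) (x : EuclideanSpace ℝ (Fin 2)) : F :=
  fderiv ℝ f x (EuclideanSpace.single i 1)

/-- The coefficients `g_ij = ⟨∂_i u, ∂_j u⟩` of the first fundamental form. -/
def gram (u : EuclideanSpace ℝ (Fin 2) → Fin 4 → ℝ) (x : EuclideanSpace ℝ (Fin 2)) :
    Matrix (Fin 2) (Fin 2) ℝ :=
  Matrix.of fun i j => ip (pd i u x) (pd j u x)

/-- The Christoffel symbols `Γᵏ_ij = ½ g^kl (∂_i g_jl + ∂_j g_il - ∂_l g_ij)` of the induced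
metric. -/
def christoffel (u : EuclideanSpace ℝ (Fin 2) → Fin 4 → ℝ) (k i j : Fin 2)
    (x : EuclideanSpace ℝ (Fin 2)) : ℝ :=
  (1 / 2) * ∑ l, (gram u x)⁻¹ k l *
    (pd i (fun y => gram u y j l) x + pd j (fun y => gram u y i l) x
      - pd l (fun y => gram u y i j) x)

/-- The pull-back to `u` of the Levi-Civita connection of `H³₁(1)`: for a vector field `V` along
`u`, tangent to `H³₁(1)`, `∇_i V` is the orthogonal projection `w ↦ w + ⟨w, u⟩ u` of the derivative
`∂_i V` in `R⁴₂` to the tangent space of `H³₁(1)` at `u`. -/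
def covDeriv (u : EuclideanSpace ℝ (Fin 2) → Fin 4 → ℝ) (i : Fin 2)
    (V : EuclideanSpace ℝ (Fin 2) → Fin 4 → ℝ) (x : EuclideanSpace ℝ (Fin 2)) : Fin 4 → ℝ :=
  pd i V x + ip (pd i V x) (u x) • u x

/-- The tension field `τ(u) = trace ∇du = g^ij (∇_i ∂_j u - Γᵏ_ij ∂_k u)`, with respect to the
induced metric. -/
def tension (u : EuclideanSpace ℝ (Fin 2) → Fin 4 → ℝ) (x : EuclideanSpace ℝ (Fin 2)) :
    Fin 4 → ℝ :=
  ∑ i, ∑ j, (gram u x)⁻¹ i j •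
    (covDeriv u i (pd j u) x - ∑ k, christoffel u k i j x • pd k u x)

/-- The rough Laplacian `trace ∇² V = g^ij (∇_i ∇_j V - Γᵏ_ij ∇_k V)` of a vector field `V`
along `u`. -/
def traceLaplacian (u V : EuclideanSpace ℝ (Fin 2) → Fin 4 → ℝ) (x : EuclideanSpace ℝ (Fin 2)) :
    Fin 4 → ℝ :=
  ∑ i, ∑ j, (gram u x)⁻¹ i j •
    (covDeriv u i (covDeriv u j V) x - ∑ k, christoffel u k i j x • covDeriv u k V x)

/-- The second tension field `τ₂(u) = trace ∇² τ - trace R(du, τ) du`. -/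
def bitension (u : EuclideanSpace ℝ (Fin 2) → Fin 4 → ℝ) (x : EuclideanSpace ℝ (Fin 2)) :
    Fin 4 → ℝ :=
  traceLaplacian u (tension u) x
    - ∑ i, ∑ j, (gram u x)⁻¹ i j • curv (pd i u x) (tension u x) (pd j u x)

/-! ### Space-like surfaces -/

section Surface

variable {M : Type*} [TopologicalSpace M] [ChartedSpace (EuclideanSpace ℝ (Fin 2)) M]

/-- `φ` is a smooth space-like immersion of the surface `M` in `H³₁(1)`: the induced metric is
positive definite. -/
structure IsSpacelikeImmersion (φ : M → Fin 4 → ℝ) : Prop where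
  smooth : ContMDiff (𝓡 2) 𝓘(ℝ, Fin 4 → ℝ) ∞ φ
  mem_adS : ∀ p, φ p ∈ adS
  spacelike : ∀ (p : M) (v : TangentSpace (𝓡 2) p), v ≠ 0 →
    0 < ip (mfderiv (𝓡 2) 𝓘(ℝ, Fin 4 → ℝ) φ p v) (mfderiv (𝓡 2) 𝓘(ℝ, Fin 4 → ℝ) φ p v)

/-- The tension field of the immersion `φ` vanishes identically: `φ` is harmonic with respect to
the induced metric or, equivalently, maximal (of mean curvature zero). -/
def IsMaximal (φ : M → Fin 4 → ℝ) : Prop :=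
  ∀ e ∈ atlas (EuclideanSpace ℝ (Fin 2)) M, ∀ x ∈ e.target, tension (φ ∘ e.symm) x = 0

/-- The second tension field of the immersion `φ`, with respect to the induced metric, vanishes
identically. -/
def IsBiharmonic (φ : M → Fin 4 → ℝ) : Prop :=
  ∀ e ∈ atlas (EuclideanSpace ℝ (Fin 2)) M, ∀ x ∈ e.target, bitension (φ ∘ e.symm) x = 0

/-- The length of tangent vectors of `M` in the metric induced by `φ`. -/
@[reducible]
def inducedENorm (φ : M → Fin 4 → ℝ) (p : M) : ENorm (TangentSpace (𝓡 2) p) where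
  enorm v := ENNReal.ofReal (Real.sqrt
    (ip (mfderiv (𝓡 2) 𝓘(ℝ, Fin 4 → ℝ) φ p v) (mfderiv (𝓡 2) 𝓘(ℝ, Fin 4 → ℝ) φ p v)))

/-- The Riemannian distance of the metric induced by `φ`: the infimum of the lengths of `C¹`
paths. It is infinite between different components. -/
def inducedEDist (φ : M → Fin 4 → ℝ) (p q : M) : ℝ≥0∞ :=
  @riemannianEDist _ _ _ _ _ (𝓡 2) M _ _ (inducedENorm φ) p q

/-- The induced metric is complete: Cauchy sequences for the Riemannian distance converge. -/
def IsCompleteSurface (φ : M → Fin 4 → ℝ) : Prop :=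
  ∀ a : ℕ → M, (∀ ε : ℝ≥0∞, 0 < ε → ∃ N, ∀ m ≥ N, ∀ n ≥ N, inducedEDist φ (a m) (a n) < ε) →
    ∃ p, Tendsto a atTop (𝓝 p)

end Surface

/-! ### The curvature tensor is the curvature of the Levi-Civita connection -/

theorem pd_ip (i : Fin 2) {V W : EuclideanSpace ℝ (Fin 2) → Fin 4 → ℝ}
    {x : EuclideanSpace ℝ (Fin 2)} (hV : DifferentiableAt ℝ V x) (hW : DifferentiableAt ℝ W x) :
    pd i (fun y => ip (V y) (W y)) x = ip (pd i V x) (W x) + ip (V x) (pd i W x) := by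
  have h1 : ∀ k, HasFDerivAt (fun y => V y k)
      ((ContinuousLinearMap.proj k).comp (fderiv ℝ V x)) x :=
    fun k => (hasFDerivAt_pi'.1 hV.hasFDerivAt) k
  have h2 : ∀ k, HasFDerivAt (fun y => W y k)
      ((ContinuousLinearMap.proj k).comp (fderiv ℝ W x)) x :=
    fun k => (hasFDerivAt_pi'.1 hW.hasFDerivAt) k
  have h := ((((h1 0).mul (h2 0)).add ((h1 1).mul (h2 1))).sub ((h1 2).mul (h2 2))).sub
    ((h1 3).mul (h2 3))
  have h' : HasFDerivAt (fun y => ip (V y) (W y)) _ x := h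
  simp only [pd]
  rw [h'.fderiv]
  simp [ip]
  ring

theorem pd_comm (i j : Fin 2) {V : EuclideanSpace ℝ (Fin 2) → Fin 4 → ℝ}
    {x : EuclideanSpace ℝ (Fin 2)} (hV : ContDiffAt ℝ ∞ V x) :
    pd i (pd j V) x = pd j (pd i V) x := by
  have hd : DifferentiableAt ℝ (fderiv ℝ V) x :=
    (hV.fderiv_right (m := 1) (by norm_cast)).differentiableAt one_ne_zero
  have h : ∀ k l : Fin 2, pd k (pd l V) x =
      fderiv ℝ (fderiv ℝ V) x (EuclideanSpace.single k 1) (EuclideanSpace.single l 1) := by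
    intro k l
    have h2 := (hd.hasFDerivAt.clm_apply
      (hasFDerivAt_const (EuclideanSpace.single l (1 : ℝ)) x)).fderiv
    have h3 : fderiv ℝ (pd l V) x = _ := h2
    rw [pd, h3]
    simp
  rw [h, h]
  exact (hV.isSymmSndFDerivAt (by simp; norm_cast)) _ _

/-- For a vector field `V` along a surface `u` in `H³₁(1)`, tangent to `H³₁(1)`, one has
`∇_i ∇_j V - ∇_j ∇_i V = R(∂_i u, ∂_j u) V`. -/
theorem covDeriv_covDeriv_sub {u V : EuclideanSpace ℝ (Fin 2) → Fin 4 → ℝ}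
    {s : Set (EuclideanSpace ℝ (Fin 2))} (hs : IsOpen s) (hu : ContDiffOn ℝ ∞ u s)
    (hV : ContDiffOn ℝ ∞ V s) (hadS : ∀ x ∈ s, u x ∈ adS) (htan : ∀ x ∈ s, ip (V x) (u x) = 0)
    (i j : Fin 2) {x : EuclideanSpace ℝ (Fin 2)} (hx : x ∈ s) :
    covDeriv u i (covDeriv u j V) x - covDeriv u j (covDeriv u i V) x
      = curv (pd i u x) (pd j u x) (V x) := by
  have hsx : s ∈ 𝓝 x := hs.mem_nhds hx
  have hux := hu.contDiffAt hsx
  have hVx := hV.contDiffAt hsx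
  have hud : DifferentiableAt ℝ u x := hux.differentiableAt (by simp)
  have hVd : DifferentiableAt ℝ V x := hVx.differentiableAt (by simp)
  have hpd : ∀ k, DifferentiableAt ℝ (pd k V) x := fun k =>
    ((hVx.fderiv_right (m := 1) (by norm_cast)).differentiableAt one_ne_zero).clm_apply
      (differentiableAt_const _)
  have h1 : ip (u x) (u x) = -1 := hadS x hx
  have hip_comm : ∀ a b, ip a b = ip b a := fun a b => by simp only [ip]; ring
  have hip_add : ∀ a b c, ip (a + b) c = ip a c + ip b c := fun a b c => by
    simp only [ip, Pi.add_apply]; ring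
  have hip_smul : ∀ (r : ℝ) a c, ip (r • a) c = r * ip a c := fun r a c => by
    simp only [ip, Pi.smul_apply, smul_eq_mul]; ring
  have h2 : ∀ k, ip (pd k u x) (u x) = 0 := by
    intro k
    have h := pd_ip k hud hud
    have h' : (fun y => ip (u y) (u y)) =ᶠ[𝓝 x] fun _ => (-1 : ℝ) :=
      Filter.mem_of_superset hsx fun y hy => hadS y hy
    have h0 : pd k (fun y => ip (u y) (u y)) x = 0 := by simp [pd, h'.fderiv_eq]
    rw [h0, hip_comm (u x)] at h
    linarith
  have h3 : ∀ k, ip (pd k V x) (u x) = -ip (pd k u x) (V x) := by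
    intro k
    have h := pd_ip k hVd hud
    have h' : (fun y => ip (V y) (u y)) =ᶠ[𝓝 x] fun _ => (0 : ℝ) :=
      Filter.mem_of_superset hsx fun y hy => htan y hy
    have h0 : pd k (fun y => ip (V y) (u y)) x = 0 := by simp [pd, h'.fderiv_eq]
    rw [h0, hip_comm (V x)] at h
    linarith
  have hipd : ∀ k, DifferentiableAt ℝ (fun y => ip (pd k V y) (u y)) x := by
    intro k
    have ha := differentiableAt_pi.1 (hpd k)
    have hb := differentiableAt_pi.1 hud
    exact ((((ha 0).mul (hb 0)).add ((ha 1).mul (hb 1))).sub ((ha 2).mul (hb 2))).sub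
      ((ha 3).mul (hb 3))
  have h4 : ∀ k l, pd k (covDeriv u l V) x = pd k (pd l V) x
      + (pd k (fun y => ip (pd l V y) (u y)) x • u x + ip (pd l V x) (u x) • pd k u x) := by
    intro k l
    have h := ((hpd l).hasFDerivAt.add ((hipd l).hasFDerivAt.smul hud.hasFDerivAt)).fderiv
    have h' : pd k (covDeriv u l V) x = fderiv ℝ
      (pd l V + (fun y => ip (pd l V y) (u y)) • u) x (EuclideanSpace.single k 1) := rfl
    rw [h', h]
    simp [pd, add_comm]
  have h5 : ∀ k l, covDeriv u k (covDeriv u l V) x = pd k (pd l V) x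
      + ip (pd k (pd l V) x) (u x) • u x - ip (pd l u x) (V x) • pd k u x := by
    intro k l
    rw [covDeriv, h4, hip_add, hip_add, hip_smul, hip_smul, h1, h2, h3]
    module
  rw [h5, h5, pd_comm i j hVx, curv]
  module

end AntiDeSitter

end

open AntiDeSitter

/-!
# Proper biharmonic space-like surfaces in anti-de Sitter 3-space

Let `τ = Hn` be the tension of a space-like surface `u`, with a unit normal field `n` of
`H³₁(1)`, so that `⟨τ, τ⟩ = -H²`, and let `L` be the Laplacian of the induced metric, acting on maps
to `R⁴₂`. Then `τ = Lu - 2u` (`LocalImmersion.tension_eq`), and, since `τ` is normal, the surface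
is biharmonic if and only if `Lτ = 2τ - ⟨τ, τ⟩u` (`LocalImmersion.bitension_eq`). In an orthonormal
frame, the tangential part of this equation says that `grad H`, where it does not vanish, is a
principal direction of curvature `-H/2`, and the normal part is an equation for the Laplacian of
`H`.

* If `H` and `grad H` have no zeros, choose the frame along the level lines of `H` and the gradient.
  The equations of Codazzi and Gauss and the normal part of the biharmonic equation become an
  overdetermined system of ordinary differential equations for `H` and the curvature of the level
  lines, which is impossible: it implies `45 H² = -28` (`BiharmonicFrame.not_gradient`). So `⟨τ, τ⟩`
  is locally constant (`LocalImmersion.pd_ip_tension`).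
* If `H` is a nonzero constant, the normal part says that the second fundamental form has squared
  length 2. A surface with distinct constant principal curvatures is flat by the equations of
  Codazzi, which contradicts the Gauss equation; so the surface is totally umbilical, with
  `H² = 4` (`BiharmonicFrame.umbilical`), and `c = u - τ / 2` is constant
  (`LocalImmersion.umbilical`).

These computations are differential algebra. They are carried out for two derivations of a
commutative ring (`BiharmonicFrame`), which is applied to the ring `SmoothRing s` of smooth
functions on an open set `s` of parameters.

The condition `⟨c, φ⟩ = -1` near a point is open, and it is closed by the local dichotomy; so it
holds on the whole connected surface if `φ` is not maximal (`exists_center`). An isometry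
that moves `c` to `(0, 0, 0, √2)` moves the surface to the slice `x₄ = 1 / √2`
(`exists_normal_form`).

There, the hyperbolic plane is a graph over the plane of the first two coordinates, and the
projection of the surface to this plane does not decrease the length of tangent vectors, as
only negative terms of the scalar product are dropped. So it is a local diffeomorphism. If the
surface is complete, segments in the plane can be lifted, since the lift of a segment has finite
length (`exists_lift_segment`); the end points of the lifts of segments starting at one point form a
continuous section, and so the projection is a bijection (`bijective_of_complete`).
-/

open AntiDeSitter

noncomputable section

namespace AntiDeSitter

/-! ### Moving frames over a differential ring -/

section Frame

variable {A : Type*} [CommRing A]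

/-- The scalar product of `R⁴₂` with coefficients in a ring `A`, later the ring of smooth functions
on an open subset of the plane. -/
def ipA (x y : Fin 4 → A) : A := x 0 * y 0 + x 1 * y 1 - x 2 * y 2 - x 3 * y 3

theorem ipA_comm (x y : Fin 4 → A) : ipA x y = ipA y x := by simp only [ipA]; ring

theorem ipA_add_left (x y z : Fin 4 → A) : ipA (x + y) z = ipA x z + ipA y z := by
  simp only [ipA, Pi.add_apply]; ring

theorem ipA_sub_left (x y z : Fin 4 → A) : ipA (x - y) z = ipA x z - ipA y z := by
  simp only [ipA, Pi.sub_apply]; ring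

theorem ipA_smul_left (r : A) (x z : Fin 4 → A) : ipA (r • x) z = r * ipA x z := by
  simp only [ipA, Pi.smul_apply, smul_eq_mul]; ring

/-- Four pseudo-orthonormal vectors of signature `(+, +, -, -)` form a basis. -/
theorem frame_expansion {e₁ e₂ n u : Fin 4 → A} (h11 : ipA e₁ e₁ = 1) (h22 : ipA e₂ e₂ = 1)
    (h12 : ipA e₁ e₂ = 0) (hnn : ipA n n = -1) (huu : ipA u u = -1) (hn1 : ipA n e₁ = 0)
    (hn2 : ipA n e₂ = 0) (hu1 : ipA u e₁ = 0) (hu2 : ipA u e₂ = 0) (hun : ipA n u = 0)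
    (V : Fin 4 → A) :
    V = ipA V e₁ • e₁ + ipA V e₂ • e₂ - ipA V n • n - ipA V u • u := by
  let P : Matrix (Fin 4) (Fin 4) A := Matrix.of ![e₁, e₂, n, u]
  let Q : Matrix (Fin 4) (Fin 4) A :=
    Matrix.of fun k => ![![1, 1, -1, -1] k * e₁ k, ![1, 1, -1, -1] k * e₂ k,
      -(![1, 1, -1, -1] k * n k), -(![1, 1, -1, -1] k * u k)]
  have hPQ : P * Q = 1 := by
    simp only [ipA] at *
    ext i j
    fin_cases i <;> fin_cases j <;>
      simp [P, Q, Matrix.mul_apply, Fin.sum_univ_four] <;>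
      first
      | linear_combination h11 | linear_combination h22 | linear_combination h12
      | linear_combination hn1 | linear_combination hn2 | linear_combination hu1
      | linear_combination hu2 | linear_combination -hn1 | linear_combination -hn2
      | linear_combination -hu1 | linear_combination -hu2 | linear_combination -hnn
      | linear_combination -huu | linear_combination -hun
  have hQP : Q * P = 1 := mul_eq_one_comm.1 hPQ
  have hV : V = Matrix.vecMul (Matrix.vecMul V Q) P := by
    rw [Matrix.vecMul_vecMul, hQP, Matrix.vecMul_one]
  ext k
  conv_lhs => rw [hV]
  simp [P, Q, Matrix.vecMul, dotProduct, Fin.sum_univ_four, ipA]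
  ring

variable [Algebra ℝ A]

/-- Componentwise action of a derivation on vectors. -/
def dv (D : Derivation ℝ A A) (V : Fin 4 → A) : Fin 4 → A := fun k => D (V k)

theorem dv_add (D : Derivation ℝ A A) (V W : Fin 4 → A) : dv D (V + W) = dv D V + dv D W := by
  ext k; simp [dv]

theorem dv_smul (D : Derivation ℝ A A) (f : A) (V : Fin 4 → A) :
    dv D (f • V) = D f • V + f • dv D V := by
  ext k; simp [dv]; ring

theorem map_ipA (D : Derivation ℝ A A) (V W : Fin 4 → A) :
    D (ipA V W) = ipA (dv D V) W + ipA (dv D W) V := by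
  simp only [ipA, dv, map_add, map_sub, Derivation.leibniz, smul_eq_mul]; ring

/-- The equations of Gauss and Codazzi, and the tangential and normal parts of the biharmonic
equation, of a space-like surface in anti-de Sitter space, in terms of an orthonormal frame
`D₁, D₂`. The second fundamental form has the coefficients `a, b, c`, its trace is `H`, and the
connection is given by `∇₁e₁ = α e₂`, `∇₂e₂ = β e₁`. -/
structure BiharmonicFrame (D₁ D₂ : Derivation ℝ A A) (H α β a b c : A) : Prop where
  trace : a + c = H
  bracket : ∀ f, D₁ (D₂ f) - D₂ (D₁ f) = -α * D₁ f + β * D₂ f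
  codazzi₁ : D₁ b - D₂ a = α * (c - a) + 2 * β * b
  codazzi₂ : D₁ c - D₂ b = -2 * α * b + β * (c - a)
  gauss : D₁ β + D₂ α = α * α + β * β - 1 - (a * c - b * b)
  tangent₁ : 2 * (D₁ H * a + D₂ H * b) + H * D₁ H = 0
  tangent₂ : 2 * (D₁ H * b + D₂ H * c) + H * D₂ H = 0
  normal : D₁ (D₁ H) + D₂ (D₂ H) - α * D₂ H - β * D₁ H + H * (a * a + 2 * (b * b) + c * c) = 2 * H

/-- The structure equations: a pseudo-orthonormal frame `D₁u, D₂u, n, u` along a surface with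
`Lu - 2u = Hn` and `L(Hn) = 2Hn + H²u`, where `L` is the Laplacian, satisfies
`BiharmonicFrame`. -/
theorem exists_biharmonicFrame {D₁ D₂ : Derivation ℝ A A} {l m p q H : A} {u n : Fin 4 → A}
    (hbr : ∀ f, D₁ (D₂ f) - D₂ (D₁ f) = l * D₁ f + m * D₂ f)
    (huu : ipA u u = -1) (h11 : ipA (dv D₁ u) (dv D₁ u) = 1) (h22 : ipA (dv D₂ u) (dv D₂ u) = 1)
    (h12 : ipA (dv D₁ u) (dv D₂ u) = 0) (hnn : ipA n n = -1) (hnu : ipA n u = 0)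
    (hn1 : ipA n (dv D₁ u) = 0) (hn2 : ipA n (dv D₂ u) = 0)
    (hτ : ∀ k, D₁ (D₁ (u k)) + D₂ (D₂ (u k)) - p * D₁ (u k) - q * D₂ (u k) - 2 * u k = H * n k)
    (hbi : ∀ k, D₁ (D₁ (H * n k)) + D₂ (D₂ (H * n k)) - p * D₁ (H * n k) - q * D₂ (H * n k)
      = 2 * (H * n k) + H * H * u k)
    (htwo : IsUnit (2 : A)) :
    ∃ α β a b c, BiharmonicFrame D₁ D₂ H α β a b c ∧
      dv D₁ n = a • dv D₁ u + b • dv D₂ u ∧ dv D₂ n = b • dv D₁ u + c • dv D₂ u := by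
  have half : ∀ x : A, x + x = 0 → x = 0 := fun x hx =>
    htwo.mul_left_cancel (by rw [two_mul, hx, mul_zero])
  have half' : ∀ {D : Derivation ℝ A A} {V : Fin 4 → A} {r : ℤ}, ipA V V = r →
      ipA (dv D V) V = 0 := by
    intro D V r h
    apply half
    rw [← map_ipA, h, Derivation.map_intCast]
  set e₁ := dv D₁ u with he1
  set e₂ := dv D₂ u with he2
  have hu1 : ipA e₁ u = 0 := half' (r := -1) (by simp [huu])
  have hu2 : ipA e₂ u = 0 := half' (r := -1) (by simp [huu])
  have hu1' : ipA u e₁ = 0 := by rw [ipA_comm, hu1]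
  have hu2' : ipA u e₂ = 0 := by rw [ipA_comm, hu2]
  have h21 : ipA e₂ e₁ = 0 := by rw [ipA_comm, h12]
  have h1n : ipA e₁ n = 0 := by rw [ipA_comm, hn1]
  have h2n : ipA e₂ n = 0 := by rw [ipA_comm, hn2]
  have hun : ipA u n = 0 := by rw [ipA_comm, hnu]
  have exp := frame_expansion h11 h22 h12 hnn huu hn1 hn2 hu1' hu2' hnu
  -- derivatives of the orthonormality relations
  have d1_11 : ipA (dv D₁ e₁) e₁ = 0 := half' (r := 1) (by simp [h11])
  have d2_11 : ipA (dv D₂ e₁) e₁ = 0 := half' (r := 1) (by simp [h11])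
  have d1_22 : ipA (dv D₁ e₂) e₂ = 0 := half' (r := 1) (by simp [h22])
  have d2_22 : ipA (dv D₂ e₂) e₂ = 0 := half' (r := 1) (by simp [h22])
  have d1_nn : ipA (dv D₁ n) n = 0 := half' (r := -1) (by simp [hnn])
  have d2_nn : ipA (dv D₂ n) n = 0 := half' (r := -1) (by simp [hnn])
  have prod : ∀ (D : Derivation ℝ A A) {V W : Fin 4 → A}, ipA V W = 0 →
      ipA (dv D V) W = - ipA (dv D W) V := by
    intro D V W h
    have := map_ipA D V W
    rw [h, map_zero] at this
    linear_combination -this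
  have d1_1u : ipA (dv D₁ e₁) u = -1 := by rw [prod D₁ hu1, ← he1, h11]
  have d2_1u : ipA (dv D₂ e₁) u = 0 := by rw [prod D₂ hu1, ← he2, h21, neg_zero]
  have d1_2u : ipA (dv D₁ e₂) u = 0 := by rw [prod D₁ hu2, ← he1, h12, neg_zero]
  have d2_2u : ipA (dv D₂ e₂) u = -1 := by rw [prod D₂ hu2, ← he2, h22]
  have d1_nu : ipA (dv D₁ n) u = 0 := by rw [prod D₁ hnu, ← he1, h1n, neg_zero]
  have d2_nu : ipA (dv D₂ n) u = 0 := by rw [prod D₂ hnu, ← he2, h2n, neg_zero]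
  have br : ∀ V, dv D₁ (dv D₂ V) - dv D₂ (dv D₁ V) = l • dv D₁ V + m • dv D₂ V := by
    intro V; ext k; simpa [dv] using hbr (V k)
  have bru : dv D₁ e₂ - dv D₂ e₁ = l • e₁ + m • e₂ := br u
  have sym : ipA (dv D₁ e₂) n = ipA (dv D₂ e₁) n := by
    have := congrArg (ipA · n) bru
    simp only [ipA_sub_left, ipA_add_left, ipA_smul_left, h1n, h2n] at this
    linear_combination this
  obtain ⟨α, hα⟩ : ∃ α, α = ipA (dv D₁ e₁) e₂ := ⟨_, rfl⟩
  obtain ⟨β, hβ⟩ : ∃ β, β = ipA (dv D₂ e₂) e₁ := ⟨_, rfl⟩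
  obtain ⟨a, ha⟩ : ∃ a, a = ipA (dv D₁ n) e₁ := ⟨_, rfl⟩
  obtain ⟨b, hb⟩ : ∃ b, b = ipA (dv D₁ n) e₂ := ⟨_, rfl⟩
  obtain ⟨c, hc⟩ : ∃ c, c = ipA (dv D₂ n) e₂ := ⟨_, rfl⟩
  have hb' : ipA (dv D₂ n) e₁ = b := by rw [prod D₂ hn1, ← sym, hb, prod D₁ hn2]
  have E1n : dv D₁ n = a • e₁ + b • e₂ := by
    rw [exp (dv D₁ n), ← ha, ← hb, d1_nn, d1_nu]; module
  have E2n : dv D₂ n = b • e₁ + c • e₂ := by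
    rw [exp (dv D₂ n), ← hc, hb', d2_nn, d2_nu]; module
  have E11 : dv D₁ e₁ = α • e₂ + a • n + u := by
    rw [exp (dv D₁ e₁), d1_11, ← hα, prod D₁ h1n, ← ha, d1_1u]; module
  have E12 : dv D₁ e₂ = (-α) • e₁ + b • n := by
    rw [exp (dv D₁ e₂), prod D₁ h21, ← hα, d1_22, prod D₁ h2n, ← hb, d1_2u]; module
  have E21 : dv D₂ e₁ = (-β) • e₂ + b • n := by
    rw [exp (dv D₂ e₁), d2_11, prod D₂ h12, ← hβ, prod D₂ h1n, hb', d2_1u]; module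
  have E22 : dv D₂ e₂ = β • e₁ + c • n + u := by
    rw [exp (dv D₂ e₂), d2_22, ← hβ, prod D₂ h2n, ← hc, d2_2u]; module
  clear_value e₁ e₂
  have eu1 : dv D₁ u = e₁ := he1.symm
  have eu2 : dv D₂ u = e₂ := he2.symm
  have hl : l = -α := by
    have := congrArg (ipA · e₁) bru
    simp only [E12, E21, ipA_sub_left, ipA_add_left, ipA_smul_left, h11, h21, hn1] at this
    linear_combination -this
  have hm : m = β := by
    have := congrArg (ipA · e₂) bru
    simp only [E12, E21, ipA_sub_left, ipA_add_left, ipA_smul_left, h22, h12, hn2] at this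
    linear_combination -this
  have hτv : dv D₁ e₁ + dv D₂ e₂ - p • e₁ - q • e₂ - (2 : A) • u = H • n := by
    ext k
    simpa [dv, he1, he2] using hτ k
  rw [E11, E22] at hτv
  have hp : p = β := by
    have := congrArg (ipA · e₁) hτv
    simp only [ipA_sub_left, ipA_add_left, ipA_smul_left, h11, h21, hn1, hu1'] at this
    linear_combination -this
  have hq : q = α := by
    have := congrArg (ipA · e₂) hτv
    simp only [ipA_sub_left, ipA_add_left, ipA_smul_left, h22, h12, hn2, hu2'] at this
    linear_combination -this
  have hH : a + c = H := by
    have := congrArg (ipA · n) hτv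
    simp only [ipA_sub_left, ipA_add_left, ipA_smul_left, h1n, h2n, hnn, hun] at this
    linear_combination -this
  subst hl hm hp hq
  have cod := br n
  rw [E1n, E2n] at cod
  simp only [dv_add, dv_smul, E11, E12, E21, E22] at cod
  have cod1 := congrArg (ipA · e₁) cod
  have cod2 := congrArg (ipA · e₂) cod
  simp only [ipA_sub_left, ipA_add_left, ipA_smul_left, h11, h21, h12, h22, hn1, hu1', hn2, hu2']
    at cod1 cod2
  have gau := congrArg (ipA · e₂) (br e₁)
  rw [E11, E21] at gau
  simp only [dv_add, dv_smul, E12, E22, E1n, E2n, eu2, ipA_sub_left, ipA_add_left,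
    ipA_smul_left, h12, h22, hn2, hu2'] at gau
  have bi : dv D₁ (dv D₁ (H • n)) + dv D₂ (dv D₂ (H • n)) - p • dv D₁ (H • n) - q • dv D₂ (H • n)
      = (2 * H) • n + (H * H) • u := by
    ext k
    simpa [dv, mul_assoc] using hbi k
  simp only [dv_add, dv_smul, E1n, E2n, E11, E12, E21, E22] at bi
  have bi1 := congrArg (ipA · e₁) bi
  have bi2 := congrArg (ipA · e₂) bi
  have bin := congrArg (ipA · n) bi
  simp only [ipA_sub_left, ipA_add_left, ipA_smul_left, h11, h21, h12, h22, hn1, hu1', hn2, hu2',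
    h1n, h2n, hnn, hun] at bi1 bi2 bin
  have t1 : D₁ a + D₁ c = D₁ H := by rw [← map_add, hH]
  have t2 : D₂ a + D₂ c = D₂ H := by rw [← map_add, hH]
  refine ⟨q, p, a, b, c, ⟨hH, hbr, ?_, ?_, ?_, ?_, ?_, ?_⟩, E1n, E2n⟩
  · linear_combination cod1
  · linear_combination cod2
  · linear_combination -gau + map_neg D₁ p
  · linear_combination bi1 - H * t1 + H * cod2
  · linear_combination bi2 - H * t2 - H * cod1
  · linear_combination -bin

end Frame

/-! ### The alternatives for the mean curvature of a biharmonic surface -/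

section FrameCases

variable {A : Type*} [CommRing A] [Algebra ℝ A] {D₁ D₂ : Derivation ℝ A A} {H α β a b c : A}

/-- The mean curvature cannot have a nonzero gradient: with `e₂` in the direction of the gradient,
`grad H` is a principal direction of curvature `-H/2`, and the equations of Codazzi and Gauss and
the normal equation become an overdetermined system of ordinary differential equations along
the `e₂`-lines, with the consequence `45 H² = -28`. -/
theorem BiharmonicFrame.not_gradient (F : BiharmonicFrame D₁ D₂ H α β a b c) (htwo : IsUnit (2 : A))
    (hH : IsUnit H) (h1 : D₁ H = 0) (h2 : IsUnit (D₂ H)) (ev : A →+* ℝ) : False := by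
  have half : ∀ x : A, x + x = 0 → x = 0 := fun x hx =>
    htwo.mul_left_cancel (by rw [two_mul, hx, mul_zero])
  -- the tangential equation makes `e₂` principal, with curvature `c = -H/2`; hence `a = 3H/2`
  have hb : b = 0 := by
    refine half b (h2.mul_left_cancel ?_)
    have := F.tangent₁
    rw [h1] at this
    linear_combination this
  have hc : c + c + H = 0 := by
    refine h2.mul_left_cancel ?_
    have := F.tangent₂
    rw [h1] at this
    linear_combination this
  have ha : a + a = 3 * H := by linear_combination 2 * F.trace - hc
  have hDc : ∀ D : Derivation ℝ A A, D c + D c + D H = 0 := by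
    intro D; rw [← map_add, ← map_add, hc, map_zero]
  have hDa : ∀ D : Derivation ℝ A A, D a + D c = D H := by
    intro D; rw [← map_add, F.trace]
  -- Codazzi: the `e₂`-lines are geodesics, and `α` is a multiple of `D₂ (log H)`
  have c1 := F.codazzi₁
  have c2 := F.codazzi₂
  have hD1c : D₁ c = 0 := half _ (by linear_combination hDc D₁ - h1)
  simp only [hb, map_zero, hD1c] at c1 c2
  have hβ : β = 0 := by
    refine half β (hH.mul_left_cancel ?_)
    linear_combination c2 + β * (hc - F.trace)
  have e1 : 4 * (α * H) = 3 * D₂ H := by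
    linear_combination -α * (ha - hc) + 2 * c1 + 2 * hDa D₂ - hDc D₂
  -- Gauss and the normal equation are then first and second order equations for `α` and `H`
  have g := F.gauss
  have nrm := F.normal
  simp only [hb, hβ, h1, map_zero] at g nrm
  have g4 : 4 * D₂ α = 4 * (α * α) - 4 + 3 * (H * H) := by
    linear_combination 4 * g + (-2 * c) * ha - 3 * H * hc
  have n4 : 4 * D₂ (D₂ H) - 4 * (α * D₂ H) + 10 * (H * H * H) = 8 * H := by
    linear_combination 4 * nrm - H * (2 * a + 3 * H) * ha - H * (2 * c - H) * hc
  have num : ∀ n : ℕ, D₂ (n : A) = 0 := fun n => D₂.map_natCast n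
  -- eliminating the derivatives leaves the algebraic relation `e2`, whose derivative is `e3`
  have e2 : 32 * (α * α) + 63 * (H * H) = 60 := by
    have h := congrArg D₂ e1
    simp only [Derivation.leibniz, smul_eq_mul, show D₂ 4 = 0 from mod_cast num 4,
      show D₂ 3 = 0 from mod_cast num 3] at h
    refine sub_eq_zero.1 (half _ (hH.mul_left_cancel ?_))
    linear_combination 12 * h + 9 * n4 - 12 * H * g4 + 4 * α * e1
  have e3 : 32 * α * D₂ α + 63 * H * D₂ H = 0 := by
    have h := congrArg D₂ e2
    simp only [map_add, Derivation.leibniz, smul_eq_mul, show D₂ 32 = 0 from mod_cast num 32,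
      show D₂ 63 = 0 from mod_cast num 63, show D₂ 60 = 0 from mod_cast num 60] at h
    exact half _ (by linear_combination h)
  have r1 := congrArg ev e1
  have r2 := congrArg ev e2
  have r3 := congrArg ev e3
  have r4 := congrArg ev g4
  have r5 : ev (D₂ H) ≠ 0 := (h2.map ev).ne_zero
  simp only [map_add, map_mul, map_sub, map_ofNat, map_zero] at r1 r2 r3 r4
  have hα : ev α ≠ 0 := by
    intro h; rw [h] at r1; apply r5; linarith
  have r6 : 8 * ev (D₂ α) + 21 * (ev H * ev H) = 0 := by
    refine mul_left_cancel₀ hα ?_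
    linear_combination (1 / 4) * r3 + (21 / 4) * ev H * r1
  nlinarith [mul_self_nonneg (ev H)]

/-- If the mean curvature is a nonzero constant, the surface is totally umbilical, with
`H² = 4`. Otherwise the principal curvatures would be distinct constants, so that the surface would
be flat by the equations of Codazzi, and the Gauss equation would give `H = 0`. As `A` is not a
domain, the conclusion is stated at a point `ev`. -/
theorem BiharmonicFrame.umbilical (F : BiharmonicFrame D₁ D₂ H α β a b c) (htwo : IsUnit (2 : A))
    (hH : IsUnit H) (h1 : D₁ H = 0) (h2 : D₂ H = 0) (ev : A →+* ℝ) :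
    ev H * ev H = 4 ∧ ev b = 0 ∧ 2 * ev a = ev H ∧ 2 * ev c = ev H := by
  have half : ∀ {x : A}, x + x = 0 → x = 0 := fun {x} hx =>
    htwo.mul_left_cancel (by rw [two_mul, hx, mul_zero])
  have hB : a * a + 2 * (b * b) + c * c = 2 := by
    refine hH.mul_left_cancel ?_
    have := F.normal
    rw [h1, h2, map_zero, map_zero] at this
    linear_combination this
  -- `p` and `q` are the components of twice the trace-free part of the second fundamental form,
  -- and `k` is its squared length
  obtain ⟨p, hp⟩ : ∃ p, p = a - c := ⟨_, rfl⟩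
  obtain ⟨q, hq⟩ : ∃ q, q = b + b := ⟨_, rfl⟩
  have hk : p * p + q * q = 4 - H * H := by
    rw [hp, hq]
    linear_combination 2 * hB - (a + c + H) * F.trace
  have hDk : ∀ D : Derivation ℝ A A, D H = 0 → p * D p + q * D q = 0 := by
    intro D hD
    refine half ?_
    have h := congrArg D hk
    have h4 : D 4 = 0 := by exact_mod_cast D.map_natCast 4
    simp only [map_add, map_sub, Derivation.leibniz, smul_eq_mul, hD, h4] at h
    linear_combination h
  have htr : ∀ D : Derivation ℝ A A, D H = 0 → D a + D c = 0 := by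
    intro D hD; rw [← map_add, F.trace, hD]
  have hDp : ∀ D : Derivation ℝ A A, D p = D a - D c := fun D => by rw [hp, map_sub]
  have hDq : ∀ D : Derivation ℝ A A, D q = D b + D b := fun D => by rw [hq, map_add]
  have k1 := hDk D₁ h1
  have k2 := hDk D₂ h2
  have c1 : D₁ q - D₂ p = -2 * (α * p) + 2 * (β * q) := by
    rw [hDp, hDq, hp, hq]
    linear_combination 2 * F.codazzi₁ + htr D₂ h2
  have c2 : D₁ p + D₂ q = 2 * (α * q) + 2 * (β * p) := by
    rw [hDp, hDq, hp, hq]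
    linear_combination -2 * F.codazzi₂ + htr D₁ h1
  obtain ⟨k, hkk⟩ : ∃ k, k = p * p + q * q := ⟨_, rfl⟩
  have dk : ∀ D : Derivation ℝ A A, D H = 0 → D k = 0 := by
    intro D hD
    rw [hkk]
    simp only [map_add, Derivation.leibniz, smul_eq_mul]
    linear_combination 2 * hDk D hD
  -- the trace-free part of the second fundamental form rotates twice as fast as the frame
  have p1 : k * D₁ p = 2 * (k * (α * q)) := by
    linear_combination p * k1 - q * (p * c1 - q * c2 + k2) + (D₁ p - 2 * (α * q)) * hkk
  have q1 : k * D₁ q = -2 * (k * (α * p)) := by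
    linear_combination q * k1 + p * (p * c1 - q * c2 + k2) + (D₁ q + 2 * (α * p)) * hkk
  have p2 : k * D₂ p = -2 * (k * (β * q)) := by linear_combination q1 - k * c1
  have q2 : k * D₂ q = 2 * (k * (β * p)) := by linear_combination k * c2 - p1
  have two : ∀ D : Derivation ℝ A A, D 2 = 0 := fun D => mod_cast D.map_natCast 2
  have neg_two : ∀ D : Derivation ℝ A A, D (-2) = 0 := fun D => by rw [map_neg, two, neg_zero]
  have g2 : 4 * (D₁ β + D₂ α - α * α - β * β) = -(2 * (H * H)) := by
    rw [hp, hq] at hk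
    linear_combination 4 * F.gauss + hk - (a + c + H) * F.trace
  -- the integrability condition of `p1`, `p2` (of `q1`, `q2`) says that the surface is flat where
  -- `k * q` (`k * p`) does not vanish, contrary to `g2`
  have zq : k * q = 0 := by
    have b1 := congrArg D₁ p2
    have b2 := congrArg D₂ p1
    simp only [Derivation.leibniz, smul_eq_mul, dk D₁ h1, dk D₂ h2, two, neg_two] at b1 b2
    refine half ((hH.mul hH).mul_left_cancel ?_)
    linear_combination k * q * g2 +
      2 * (k * F.bracket p - b1 + b2 - α * p1 + β * p2 + 2 * β * q1 + 2 * α * q2)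
  have zp : k * p = 0 := by
    have b1 := congrArg D₁ q2
    have b2 := congrArg D₂ q1
    simp only [Derivation.leibniz, smul_eq_mul, dk D₁ h1, dk D₂ h2, two, neg_two] at b1 b2
    refine half ((hH.mul hH).mul_left_cancel ?_)
    linear_combination k * p * g2 -
      2 * (k * F.bracket q - b1 + b2 - α * q1 + β * q2 - 2 * β * p1 - 2 * α * p2)
  have zk : k * k = 0 := by
    linear_combination p * zp + q * zq + k * hkk
  have ek : ev k = 0 := by
    have := congrArg ev zk
    rwa [map_mul, map_zero, mul_self_eq_zero] at this
  have e0 : ev p * ev p + ev q * ev q = 0 := by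
    rw [← ek, hkk, map_add, map_mul, map_mul]
  have ep : ev p = 0 := by nlinarith [mul_self_nonneg (ev p), mul_self_nonneg (ev q)]
  have eq : ev q = 0 := by nlinarith [mul_self_nonneg (ev p), mul_self_nonneg (ev q)]
  have eH := congrArg ev hk
  have et := congrArg ev F.trace
  simp only [map_add, map_sub, map_mul, map_ofNat, e0] at eH et
  rw [hp, map_sub] at ep
  rw [hq, map_add] at eq
  refine ⟨?_, ?_, ?_, ?_⟩ <;> linarith

end FrameCases

/-! ### The differential ring of smooth functions on an open subset of the plane -/

section SmoothRing

open TopologicalSpace (Opens)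

/-- The coordinate plane. -/
abbrev Plane := EuclideanSpace ℝ (Fin 2)

section PartialDerivatives

variable {F : Type*} [NormedAddCommGroup F] [NormedSpace ℝ F] {x : Plane} {i j : Fin 2}

theorem pd_congr {f g : Plane → F} (h : f =ᶠ[𝓝 x] g) : pd i f x = pd i g x := by
  simp only [pd, h.fderiv_eq]

theorem contDiffOn_pd {f : Plane → F} {s : Opens Plane} (hf : ContDiffOn ℝ ∞ f s) :
    ContDiffOn ℝ ∞ (pd i f) s :=
  ((hf.fderiv_of_isOpen s.isOpen (m := ∞) (by simp)).clm_apply contDiffOn_const)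

theorem pd_pd_comm {f : Plane → F} (hf : ContDiffAt ℝ ∞ f x) :
    pd i (pd j f) x = pd j (pd i f) x := by
  have hd : DifferentiableAt ℝ (fderiv ℝ f) x :=
    (hf.fderiv_right (m := 1) (by norm_cast)).differentiableAt one_ne_zero
  have h : ∀ k l : Fin 2, pd k (pd l f) x =
      fderiv ℝ (fderiv ℝ f) x (EuclideanSpace.single k 1) (EuclideanSpace.single l 1) := by
    intro k l
    have h2 : fderiv ℝ (pd l f) x = _ := (hd.hasFDerivAt.clm_apply
      (hasFDerivAt_const (EuclideanSpace.single l (1 : ℝ)) x)).fderiv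
    rw [pd, h2]
    simp
  rw [h, h]
  exact (hf.isSymmSndFDerivAt (by simp; norm_cast)) _ _

theorem pd_apply {V : Plane → Fin 4 → ℝ} (hV : DifferentiableAt ℝ V x) (k : Fin 4) :
    pd i V x k = pd i (fun y => V y k) x := by
  simp only [pd]
  rw [((hasFDerivAt_pi'.1 hV.hasFDerivAt) k).fderiv]
  simp

end PartialDerivatives

/-- The algebra of smooth real functions on the open set `s`. -/
def smoothSubalgebra (s : Opens Plane) : Subalgebra ℝ (s → ℝ) where
  carrier := {f | ∃ g : Plane → ℝ, ContDiffOn ℝ ∞ g s ∧ ∀ x : s, f x = g x}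
  mul_mem' := by
    rintro f f' ⟨g, hg, h⟩ ⟨g', hg', h'⟩
    exact ⟨_, hg.mul hg', fun x => by simp [h, h']⟩
  add_mem' := by
    rintro f f' ⟨g, hg, h⟩ ⟨g', hg', h'⟩
    exact ⟨_, hg.add hg', fun x => by simp [h, h']⟩
  algebraMap_mem' := fun r => ⟨fun _ => r, contDiffOn_const, fun x => rfl⟩

/-- The ring of smooth real functions on the open set `s`, a type of its own so that instances are
found quickly. -/
def SmoothRing (s : Opens Plane) : Type := smoothSubalgebra s

instance (s : Opens Plane) : CommRing (SmoothRing s) :=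
  inferInstanceAs (CommRing (smoothSubalgebra s))

instance (s : Opens Plane) : Algebra ℝ (SmoothRing s) :=
  inferInstanceAs (Algebra ℝ (smoothSubalgebra s))

namespace SmoothRing

variable {s : Opens Plane}

/-- The element of the ring defined by a function that is smooth on `s`. -/
def of (g : Plane → ℝ) (hg : ContDiffOn ℝ ∞ g s) : SmoothRing s :=
  ⟨fun x => g x, g, hg, fun _ => rfl⟩

@[simp]
theorem of_apply (g : Plane → ℝ) (hg : ContDiffOn ℝ ∞ g s) (x : s) : (of g hg).1 x = g x := rfl

/-- A function on the plane that represents an element of the ring. Its values off `s` are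
arbitrary. -/
def rep (f : SmoothRing s) : Plane → ℝ := f.2.choose

theorem contDiffOn_rep (f : SmoothRing s) : ContDiffOn ℝ ∞ (rep f) s := f.2.choose_spec.1

theorem rep_apply (f : SmoothRing s) (x : s) : (rep f) x = f.1 x := (f.2.choose_spec.2 x).symm

theorem differentiableAt_rep (f : SmoothRing s) (x : s) : DifferentiableAt ℝ (rep f) x :=
  ((contDiffOn_rep f).contDiffAt (s.isOpen.mem_nhds x.2)).differentiableAt (by simp)

theorem rep_eventuallyEq {f : SmoothRing s} {g : Plane → ℝ} (h : ∀ y : s, f.1 y = g y) (x : s) :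
    (rep f) =ᶠ[𝓝 (x : Plane)] g :=
  mem_of_superset (s.isOpen.mem_nhds x.2) fun y hy => (rep_apply f ⟨y, hy⟩).trans (h ⟨y, hy⟩)

/-- The `i`-th partial derivative as a derivation. -/
def partialD (i : Fin 2) : Derivation ℝ (SmoothRing s) (SmoothRing s) :=
  Derivation.mk'
    { toFun := fun f => of (pd i (rep f)) (contDiffOn_pd (contDiffOn_rep f))
      map_add' := by
        intro f g
        refine Subtype.ext (funext fun x => ?_)
        have h := rep_eventuallyEq (f := f + g) (g := (rep f) + (rep g))
          (fun y => (congrArg₂ (· + ·) (rep_apply f y) (rep_apply g y)).symm) x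
        change pd i (rep (f + g)) x = pd i (rep f) x + pd i (rep g) x
        rw [pd_congr h]
        simp [pd, fderiv_add ((differentiableAt_rep f) x) ((differentiableAt_rep g) x)]
      map_smul' := by
        intro r f
        refine Subtype.ext (funext fun x => ?_)
        have h := rep_eventuallyEq (f := r • f) (g := r • (rep f))
          (fun y => (congrArg (r * ·) (rep_apply f y)).symm) x
        change pd i (rep (r • f)) x = r * pd i (rep f) x
        rw [pd_congr h]
        simp [pd, fderiv_const_smul ((differentiableAt_rep f) x)] }
    (by
      intro f g
      refine Subtype.ext (funext fun x => ?_)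
      have h := rep_eventuallyEq (f := f * g) (g := (rep f) * (rep g))
        (fun y => (congrArg₂ (· * ·) (rep_apply f y) (rep_apply g y)).symm) x
      change pd i (rep (f * g)) x = f.1 x * pd i (rep g) x + g.1 x * pd i (rep f) x
      rw [pd_congr h, ← (rep_apply f), ← (rep_apply g)]
      simp [pd, fderiv_mul ((differentiableAt_rep f) x) ((differentiableAt_rep g) x)])

theorem partialD_apply (i : Fin 2) {f : SmoothRing s} {g : Plane → ℝ} (h : ∀ y : s, f.1 y = g y)
    (x : s) : (partialD i f).1 x = pd i g x :=
  pd_congr (rep_eventuallyEq h x)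

theorem partialD_comm (i j : Fin 2) (f : SmoothRing s) :
    partialD i (partialD j f) = partialD j (partialD i f) := by
  refine Subtype.ext (funext fun x => ?_)
  have h (k : Fin 2) (y : s) : (partialD k f).1 y = pd k (rep f) y :=
    partialD_apply k (fun z => (rep_apply f z).symm) y
  rw [partialD_apply i (h j), partialD_apply j (h i)]
  exact pd_pd_comm ((contDiffOn_rep f).contDiffAt (s.isOpen.mem_nhds x.2))

/-- Evaluation at a point. -/
def ev (x : s) : SmoothRing s →+* ℝ :=
  (Pi.evalRingHom (fun _ : s => ℝ) x).comp (smoothSubalgebra s).val.toRingHom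

@[simp]
theorem ev_apply (x : s) (f : SmoothRing s) : ev x f = f.1 x := rfl

theorem ext_ev {f g : SmoothRing s} (h : ∀ x : s, f.1 x = g.1 x) : f = g :=
  Subtype.ext (funext h)

theorem isUnit_two : IsUnit (2 : SmoothRing s) := by
  have h : IsUnit (2 : ℝ) := isUnit_iff_ne_zero.2 two_ne_zero
  have h' := h.map (algebraMap ℝ (SmoothRing s))
  rwa [map_ofNat] at h'

theorem isUnit_of_ne_zero {f : SmoothRing s} (h : ∀ x : s, f.1 x ≠ 0) : IsUnit f := by
  refine IsUnit.of_mul_eq_one (of (fun x => (rep f x)⁻¹) ((contDiffOn_rep f).inv fun x hx => ?_)) ?_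
  · exact (rep_apply f ⟨x, hx⟩).symm ▸ h ⟨x, hx⟩
  · refine ext_ev fun x => ?_
    change f.1 x * ((rep f) x)⁻¹ = 1
    rw [rep_apply, mul_inv_cancel₀ (h x)]

theorem exists_sqrt {f : SmoothRing s} (h : ∀ x : s, 0 < f.1 x) :
    ∃ r : SmoothRing s, r * r = f ∧ ∀ x : s, 0 < r.1 x := by
  refine ⟨of (fun x => √((rep f) x)) ((contDiffOn_rep f).sqrt fun x hx => ?_), ?_, ?_⟩
  · exact (rep_apply f ⟨x, hx⟩).symm ▸ (h ⟨x, hx⟩).ne'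
  · refine ext_ev fun x => ?_
    change √((rep f) x) * √((rep f) x) = f.1 x
    rw [rep_apply, Real.mul_self_sqrt (h x).le]
  · intro x
    change 0 < √((rep f) x)
    rw [rep_apply]
    exact Real.sqrt_pos.2 (h x)

/-- The derivation along the vector field with components `X`. -/
def dir (X : Fin 2 → SmoothRing s) : Derivation ℝ (SmoothRing s) (SmoothRing s) :=
  X 0 • partialD 0 + X 1 • partialD 1

theorem dir_apply (X : Fin 2 → SmoothRing s) (f : SmoothRing s) :
    dir X f = X 0 * partialD 0 f + X 1 * partialD 1 f := by
  simp [dir]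

/-- The value at `V, W` of the bilinear form with symmetric coefficients `g`. -/
def form (g : Fin 2 → Fin 2 → SmoothRing s) (V W : Fin 2 → SmoothRing s) : SmoothRing s :=
  g 0 0 * V 0 * W 0 + g 0 1 * (V 0 * W 1 + V 1 * W 0) + g 1 1 * V 1 * W 1

/-- A nowhere vanishing vector field can be normalized and completed to an orthonormal frame. -/
theorem exists_orthonormal {g : Fin 2 → Fin 2 → SmoothRing s}
    (h00 : ∀ x : s, 0 < (g 0 0).1 x)
    (hdet : ∀ x : s, 0 < (g 0 0 * g 1 1 - g 0 1 * g 0 1).1 x) (Z : Fin 2 → SmoothRing s)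
    (hZ : ∀ x : s, (Z 0).1 x ≠ 0 ∨ (Z 1).1 x ≠ 0) :
    ∃ (r : SmoothRing s) (Y : Fin 2 → SmoothRing s), form g (r • Z) (r • Z) = 1 ∧
      form g (r • Z) Y = 0 ∧ form g Y Y = 1 := by
  have hpos : ∀ x : s, 0 < (form g Z Z).1 x := by
    intro x
    have e0 := h00 x
    have e1 := hdet x
    simp only [← ev_apply, form, map_add, map_mul, map_sub] at *
    have hZx := hZ x
    have key : 0 < ev x (g 0 0) * (ev x (g 0 0) * ev x (Z 0) * ev x (Z 0)
        + ev x (g 0 1) * (ev x (Z 0) * ev x (Z 1) + ev x (Z 1) * ev x (Z 0))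
        + ev x (g 1 1) * ev x (Z 1) * ev x (Z 1)) := by
      have e : ev x (g 0 0) * (ev x (g 0 0) * ev x (Z 0) * ev x (Z 0)
        + ev x (g 0 1) * (ev x (Z 0) * ev x (Z 1) + ev x (Z 1) * ev x (Z 0))
        + ev x (g 1 1) * ev x (Z 1) * ev x (Z 1))
          = (ev x (g 0 0) * ev x (Z 0) + ev x (g 0 1) * ev x (Z 1)) ^ 2
            + (ev x (g 0 0) * ev x (g 1 1) - ev x (g 0 1) * ev x (g 0 1)) * ev x (Z 1) ^ 2 := by
        ring
      rw [e]
      by_cases h1 : ev x (Z 1) = 0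
      · have h0 : ev x (Z 0) ≠ 0 := hZx.resolve_right (not_not.2 h1)
        have := mul_ne_zero e0.ne' h0
        rw [h1]
        simp only [mul_zero, add_zero]
        positivity
      · positivity
    exact pos_of_mul_pos_right key e0.le
  obtain ⟨ρ, hρ, -⟩ := exists_sqrt hpos
  obtain ⟨δ, hδ, -⟩ := exists_sqrt hdet
  have uρ : IsUnit ρ := isUnit_of_mul_isUnit_left
    (hρ.symm ▸ isUnit_of_ne_zero fun x => (hpos x).ne')
  have uδ : IsUnit δ := isUnit_of_mul_isUnit_left
    (hδ.symm ▸ isUnit_of_ne_zero fun x => (hdet x).ne')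
  obtain ⟨r, hr⟩ := uρ.exists_right_inv
  obtain ⟨w, hw⟩ := uδ.exists_right_inv
  have hX : form g (r • Z) (r • Z) = 1 := by
    have : form g (r • Z) (r • Z) = r * r * form g Z Z := by
      simp only [form, Pi.smul_apply, smul_eq_mul]; ring
    rw [this, ← hρ]
    linear_combination (ρ * r + 1) * hr
  -- the rotation by a right angle: the metric dual of `r • Z`, turned
  refine ⟨r, ![-w * r * (g 0 1 * Z 0 + g 1 1 * Z 1), w * r * (g 0 0 * Z 0 + g 0 1 * Z 1)],
    hX, ?_, ?_⟩
  · simp [form]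
    ring
  · have hww : w * w * (g 0 0 * g 1 1 - g 0 1 * g 0 1) = 1 := by
      rw [← hδ]; linear_combination (δ * w + 1) * hw
    simp [form] at hX ⊢
    linear_combination (w * w * (g 0 0 * g 1 1 - g 0 1 * g 0 1)) * hX + hww

end SmoothRing

end SmoothRing

/-! ### The tension and the second tension in coordinates -/

section Coordinates

open TopologicalSpace (Opens)

theorem ip_comm (x y : Fin 4 → ℝ) : ip x y = ip y x := ipA_comm x y

theorem ip_add_left (x y z : Fin 4 → ℝ) : ip (x + y) z = ip x z + ip y z := ipA_add_left x y z

theorem ip_sub_left (x y z : Fin 4 → ℝ) : ip (x - y) z = ip x z - ip y z := ipA_sub_left x y z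

theorem ip_smul_left (r : ℝ) (x z : Fin 4 → ℝ) : ip (r • x) z = r * ip x z := ipA_smul_left r x z

theorem ip_lincomb (a b : ℝ) (x y : Fin 4 → ℝ) :
    ip (a • x + b • y) (a • x + b • y) = a * a * ip x x + 2 * a * b * ip x y + b * b * ip y y := by
  simp only [ip, Pi.add_apply, Pi.smul_apply, smul_eq_mul]; ring

theorem ip_sum_left {ι : Type*} (t : Finset ι) (f : ι → Fin 4 → ℝ) (z : Fin 4 → ℝ) :
    ip (∑ i ∈ t, f i) z = ∑ i ∈ t, ip (f i) z := by
  let l : (Fin 4 → ℝ) →+ ℝ :=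
    { toFun := fun x => ip x z
      map_zero' := by simp [ip]
      map_add' := fun x y => ip_add_left x y z }
  exact map_sum l f t

theorem contDiffOn_ip {V W : Plane → Fin 4 → ℝ} {s : Set Plane} (hV : ContDiffOn ℝ ∞ V s)
    (hW : ContDiffOn ℝ ∞ W s) : ContDiffOn ℝ ∞ (fun x => ip (V x) (W x)) s := by
  have a := contDiffOn_pi.1 hV
  have b := contDiffOn_pi.1 hW
  exact ((((a 0).mul (b 0)).add ((a 1).mul (b 1))).sub ((a 2).mul (b 2))).sub ((a 3).mul (b 3))

/-- A parametrized space-like surface in anti-de Sitter space, with the open set `s` of parameters.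
The values of `u` off `s` are irrelevant. -/
structure LocalImmersion (s : Opens Plane) (u : Plane → Fin 4 → ℝ) : Prop where
  smooth : ContDiffOn ℝ ∞ u s
  mem_adS : ∀ x ∈ s, u x ∈ adS
  spacelike : ∀ x ∈ s, ∀ v : Plane, v ≠ 0 → 0 < ip (fderiv ℝ u x v) (fderiv ℝ u x v)

theorem fderiv_eq_pd {F : Type*} [NormedAddCommGroup F] [NormedSpace ℝ F] (f : Plane → F)
    (x v : Plane) : fderiv ℝ f x v = v 0 • pd 0 f x + v 1 • pd 1 f x := by
  have hv : v = v 0 • EuclideanSpace.single 0 1 + v 1 • EuclideanSpace.single 1 1 := by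
    ext i; fin_cases i <;> simp
  conv_lhs => rw [hv]
  simp only [map_add, map_smul, pd]

/-- The Laplacian of the metric induced by `u`, on functions with values in a vector space. -/
def lap {F : Type*} [NormedAddCommGroup F] [NormedSpace ℝ F] (u : Plane → Fin 4 → ℝ)
    (f : Plane → F) (x : Plane) : F :=
  ∑ i, ∑ j, (gram u x)⁻¹ i j • (pd i (pd j f) x - ∑ k, christoffel u k i j x • pd k f x)

theorem gram_symm (u : Plane → Fin 4 → ℝ) (x : Plane) (i j : Fin 2) :
    gram u x i j = gram u x j i := ip_comm _ _

namespace LocalImmersion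

variable {s : Opens Plane} {u : Plane → Fin 4 → ℝ} (hu : LocalImmersion s u)
include hu

theorem mono {t : Opens Plane} (h : t ≤ s) : LocalImmersion t u :=
  ⟨hu.smooth.mono h, fun x hx => hu.mem_adS x (h hx), fun x hx => hu.spacelike x (h hx)⟩

theorem gram_pos {x : Plane} (hx : x ∈ s) : 0 < gram u x 0 0 := by
  have h := hu.spacelike x hx (EuclideanSpace.single 0 1) (by simp)
  exact h

theorem gram_det_pos {x : Plane} (hx : x ∈ s) :
    0 < gram u x 0 0 * gram u x 1 1 - gram u x 0 1 * gram u x 0 1 := by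
  have h0 := hu.gram_pos hx
  have h := hu.spacelike x hx (!₂[-gram u x 0 1, gram u x 0 0]) (by
    intro h
    have := congrArg (fun v : Plane => v 1) h
    simp at this
    exact h0.ne' this)
  rw [fderiv_eq_pd, ip_lincomb] at h
  refine (mul_pos_iff_of_pos_left h0).1 (h.trans_eq ?_)
  simp only [gram, Matrix.of_apply, Matrix.cons_val_zero, Matrix.cons_val_one]
  ring

theorem isUnit_det {x : Plane} (hx : x ∈ s) : IsUnit (gram u x).det := by
  rw [Matrix.det_fin_two, gram_symm u x 1 0]
  exact isUnit_iff_ne_zero.2 (hu.gram_det_pos hx).ne'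

theorem inv_mul {x : Plane} (hx : x ∈ s) (i j : Fin 2) :
    ∑ k, (gram u x)⁻¹ i k * gram u x k j = if i = j then 1 else 0 := by
  have := congrFun (congrFun (Matrix.nonsing_inv_mul (gram u x) (hu.isUnit_det hx)) i) j
  rwa [Matrix.mul_apply, Matrix.one_apply] at this

omit hu in
theorem inv_symm (x : Plane) (i j : Fin 2) : (gram u x)⁻¹ i j = (gram u x)⁻¹ j i := by
  have h : (gram u x).transpose = gram u x := by ext i j; exact gram_symm u x j i
  have := Matrix.transpose_nonsing_inv (gram u x)
  rw [h] at this
  exact congrFun (congrFun this j) i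

theorem inv_contract {x : Plane} (hx : x ∈ s) :
    ∑ i, ∑ j, (gram u x)⁻¹ i j * gram u x i j = 2 := by
  have : ∀ i, ∑ j, (gram u x)⁻¹ i j * gram u x i j = 1 := by
    intro i
    rw [← if_pos (c := i = i) (t := (1 : ℝ)) (e := 0) rfl, ← hu.inv_mul hx i i]
    exact Finset.sum_congr rfl fun j _ => by rw [gram_symm u x i j]
  simp [this]

theorem contDiffOn_gram (i j : Fin 2) : ContDiffOn ℝ ∞ (fun x => gram u x i j) s :=
  contDiffOn_ip (contDiffOn_pd hu.smooth) (contDiffOn_pd hu.smooth)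

theorem contDiffOn_inv (i j : Fin 2) : ContDiffOn ℝ ∞ (fun x => (gram u x)⁻¹ i j) s := by
  have h : ∀ x, (gram u x)⁻¹ i j = (gram u x 0 0 * gram u x 1 1 - gram u x 0 1 * gram u x 1 0)⁻¹ *
      (!![gram u x 1 1, -gram u x 0 1; -gram u x 1 0, gram u x 0 0] : Matrix _ _ ℝ) i j := by
    intro x
    rw [Matrix.inv_def, Matrix.adjugate_fin_two, Matrix.det_fin_two, Ring.inverse_eq_inv']
    rfl
  simp only [h]
  refine ContDiffOn.mul (ContDiffOn.inv ?_ fun x hx => ?_) ?_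
  · exact ((hu.contDiffOn_gram 0 0).mul (hu.contDiffOn_gram 1 1)).sub
      ((hu.contDiffOn_gram 0 1).mul (hu.contDiffOn_gram 1 0))
  · rw [gram_symm u x 1 0]
    exact (hu.gram_det_pos hx).ne'
  · fin_cases i <;> fin_cases j
    exacts [hu.contDiffOn_gram 1 1, (hu.contDiffOn_gram 0 1).neg, (hu.contDiffOn_gram 1 0).neg,
      hu.contDiffOn_gram 0 0]

theorem contDiffOn_christoffel (k i j : Fin 2) : ContDiffOn ℝ ∞ (christoffel u k i j) s := by
  refine contDiffOn_const.mul (ContDiffOn.sum fun l _ => (hu.contDiffOn_inv k l).mul ?_)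
  exact ((contDiffOn_pd (hu.contDiffOn_gram j l)).add (contDiffOn_pd (hu.contDiffOn_gram i l))).sub
    (contDiffOn_pd (hu.contDiffOn_gram i j))

theorem contDiffOn_lap {F : Type*} [NormedAddCommGroup F] [NormedSpace ℝ F] {f : Plane → F}
    (hf : ContDiffOn ℝ ∞ f s) : ContDiffOn ℝ ∞ (lap u f) s :=
  ContDiffOn.sum fun i _ => ContDiffOn.sum fun j _ => (hu.contDiffOn_inv i j).smul
    ((contDiffOn_pd (contDiffOn_pd hf)).sub
      (ContDiffOn.sum fun k _ => (hu.contDiffOn_christoffel k i j).smul (contDiffOn_pd hf)))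

omit hu in
theorem differentiableAt {F : Type*} [NormedAddCommGroup F] [NormedSpace ℝ F] {f : Plane → F}
    (hf : ContDiffOn ℝ ∞ f s) {x : Plane} (hx : x ∈ s) : DifferentiableAt ℝ f x :=
  (hf.contDiffAt (s.isOpen.mem_nhds hx)).differentiableAt (by simp)

omit hu in
/-- The derivative of a scalar product that is constant on `s`. -/
theorem ip_pd_of_const {V W : Plane → Fin 4 → ℝ} (hV : ContDiffOn ℝ ∞ V s)
    (hW : ContDiffOn ℝ ∞ W s) {r : ℝ} (h : ∀ x ∈ s, ip (V x) (W x) = r) {x : Plane} (hx : x ∈ s)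
    (i : Fin 2) : ip (pd i V x) (W x) = -ip (V x) (pd i W x) := by
  have h1 := pd_ip i (differentiableAt hV hx) (differentiableAt hW hx)
  have h2 : (fun y => ip (V y) (W y)) =ᶠ[𝓝 x] fun _ => r :=
    mem_of_superset (s.isOpen.mem_nhds hx) h
  rw [pd_congr h2] at h1
  simp [pd] at h1
  simp only [pd]
  linarith

theorem ip_pd_self {x : Plane} (hx : x ∈ s) (i : Fin 2) : ip (pd i u x) (u x) = 0 := by
  have := ip_pd_of_const hu.smooth hu.smooth hu.mem_adS hx i
  rw [ip_comm (u x)] at this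
  linarith

theorem ip_pd_pd_self {x : Plane} (hx : x ∈ s) (i j : Fin 2) :
    ip (pd i (pd j u) x) (u x) = -gram u x i j := by
  rw [ip_pd_of_const (contDiffOn_pd hu.smooth) hu.smooth (fun y hy => hu.ip_pd_self hy j) hx i,
    ip_comm]
  rfl

/-- The tangential part of the second derivatives is given by the Christoffel symbols. -/
theorem sum_christoffel {x : Plane} (hx : x ∈ s) (i j l : Fin 2) :
    ∑ k, christoffel u k i j x * gram u x k l = ip (pd i (pd j u) x) (pd l u x) := by
  have hd := fun k => differentiableAt (contDiffOn_pd (i := k) hu.smooth) hx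
  have hg : ∀ i j l, pd i (fun y => gram u y j l) x =
      ip (pd i (pd j u) x) (pd l u x) + ip (pd j u x) (pd i (pd l u) x) :=
    fun i j l => pd_ip i (hd j) (hd l)
  have hc := hu.smooth.contDiffAt (s.isOpen.mem_nhds hx)
  have h1 : ∀ m, pd i (fun y => gram u y j m) x + pd j (fun y => gram u y i m) x
      - pd m (fun y => gram u y i j) x = 2 * ip (pd i (pd j u) x) (pd m u x) := by
    intro m
    rw [hg, hg, hg, pd_pd_comm (i := j) (j := i) hc, pd_pd_comm (i := m) (j := i) hc,
      pd_pd_comm (i := m) (j := j) hc, ip_comm (pd j u x), ip_comm (pd i u x)]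
    ring
  simp only [christoffel, h1]
  have h2 : ∀ m, ∑ k, (gram u x)⁻¹ k m * gram u x k l = if m = l then 1 else 0 := by
    intro m
    rw [← hu.inv_mul hx]
    exact Finset.sum_congr rfl fun k _ => by rw [inv_symm]
  have h20 := h2 0
  have h21 := h2 1
  simp only [Fin.sum_univ_two] at h20 h21 ⊢
  fin_cases l <;> simp at h20 h21 ⊢
  · linear_combination ip (pd i (pd j u) x) (pd 0 u x) * h20
      + ip (pd i (pd j u) x) (pd 1 u x) * h21
  · linear_combination ip (pd i (pd j u) x) (pd 0 u x) * h20
      + ip (pd i (pd j u) x) (pd 1 u x) * h21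

theorem lap_ip_pd {x : Plane} (hx : x ∈ s) (l : Fin 2) : ip (lap u u x) (pd l u x) = 0 := by
  simp only [lap, ip_sum_left, ip_smul_left, ip_sub_left]
  refine Finset.sum_eq_zero fun i _ => Finset.sum_eq_zero fun j _ => ?_
  rw [← hu.sum_christoffel hx i j l]
  simp [gram]

/-- The formula of Beltrami: the tension is the part of the Laplacian of `u` in `R⁴₂` that is
tangent to anti-de Sitter space. -/
theorem tension_eq {x : Plane} (hx : x ∈ s) : tension u x = lap u u x - (2 : ℝ) • u x := by
  simp only [tension, lap, covDeriv, hu.ip_pd_pd_self hx]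
  rw [← hu.inv_contract hx, Finset.sum_smul, ← Finset.sum_sub_distrib]
  refine Finset.sum_congr rfl fun i _ => ?_
  rw [Finset.sum_smul, ← Finset.sum_sub_distrib]
  refine Finset.sum_congr rfl fun j _ => ?_
  module

theorem contDiffOn_tension : ContDiffOn ℝ ∞ (tension u) s :=
  ((hu.contDiffOn_lap hu.smooth).sub (hu.smooth.const_smul (2 : ℝ))).congr
    fun _ hx => hu.tension_eq hx

theorem tension_ip_pd {x : Plane} (hx : x ∈ s) (l : Fin 2) : ip (tension u x) (pd l u x) = 0 := by
  rw [hu.tension_eq hx, ip_sub_left, ip_smul_left, hu.lap_ip_pd hx, ip_comm, hu.ip_pd_self hx]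
  ring

/-- By `⟨u, u⟩ = -1`, the component of the Laplacian of `u` along `u` is the metric trace of the
first fundamental form. -/
theorem lap_ip_self {x : Plane} (hx : x ∈ s) : ip (lap u u x) (u x) = -2 := by
  simp only [lap, ip_sum_left, ip_smul_left, ip_sub_left, hu.ip_pd_pd_self hx, hu.ip_pd_self hx]
  rw [← hu.inv_contract hx, ← Finset.sum_neg_distrib]
  refine Finset.sum_congr rfl fun i _ => ?_
  rw [← Finset.sum_neg_distrib]
  refine Finset.sum_congr rfl fun j _ => ?_
  simp

theorem tension_ip_self {x : Plane} (hx : x ∈ s) : ip (tension u x) (u x) = 0 := by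
  have h : ip (u x) (u x) = -1 := hu.mem_adS x hx
  rw [hu.tension_eq hx, ip_sub_left, ip_smul_left, hu.lap_ip_self hx, h]
  ring

theorem covDeriv_covDeriv {V : Plane → Fin 4 → ℝ} (hV : ContDiffOn ℝ ∞ V s)
    (htan : ∀ x ∈ s, ip (V x) (u x) = 0) {x : Plane} (hx : x ∈ s) (i j : Fin 2) :
    covDeriv u i (covDeriv u j V) x = pd i (pd j V) x + ip (pd i (pd j V) x) (u x) • u x
      - ip (pd j u x) (V x) • pd i u x := by
  have hp := differentiableAt (contDiffOn_pd (i := j) hV) hx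
  have hud := differentiableAt hu.smooth hx
  have hip := differentiableAt (contDiffOn_ip (contDiffOn_pd (i := j) hV) hu.smooth) hx
  have h3 : ip (pd j V x) (u x) = -ip (pd j u x) (V x) := by
    rw [ip_pd_of_const hV hu.smooth htan hx, ip_comm]
  have h4 : pd i (covDeriv u j V) x = pd i (pd j V) x
      + (pd i (fun y => ip (pd j V y) (u y)) x • u x + ip (pd j V x) (u x) • pd i u x) := by
    have h := (hp.hasFDerivAt.add (hip.hasFDerivAt.smul hud.hasFDerivAt)).fderiv
    have h' : pd i (covDeriv u j V) x = fderiv ℝ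
      (pd j V + (fun y => ip (pd j V y) (u y)) • u) x (EuclideanSpace.single i 1) := rfl
    rw [h', h]
    simp [pd, add_comm]
  have h1 : ip (u x) (u x) = -1 := hu.mem_adS x hx
  rw [covDeriv, h4, ip_add_left, ip_add_left, ip_smul_left, ip_smul_left, h1, hu.ip_pd_self hx, h3]
  module

theorem traceLaplacian_eq {V : Plane → Fin 4 → ℝ} (hV : ContDiffOn ℝ ∞ V s)
    (htan : ∀ x ∈ s, ip (V x) (u x) = 0) (hnor : ∀ x ∈ s, ∀ l, ip (V x) (pd l u x) = 0)
    {x : Plane} (hx : x ∈ s) :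
    traceLaplacian u V x = lap u V x + ip (lap u V x) (u x) • u x := by
  simp only [traceLaplacian, lap, hu.covDeriv_covDeriv hV htan hx, ip_comm (pd _ u x) (V x),
    hnor x hx, ip_sum_left, ip_smul_left, ip_sub_left, Finset.sum_smul, ← Finset.sum_add_distrib]
  refine Finset.sum_congr rfl fun i _ => Finset.sum_congr rfl fun j _ => ?_
  simp only [covDeriv, Fin.sum_univ_two]
  module

theorem lap_tension_ip_self {x : Plane} (hx : x ∈ s) :
    ip (lap u (tension u) x) (u x) = ip (tension u x) (tension u x) := by
  have h0 : ∀ y ∈ s, ∀ k, ip (pd k (tension u) y) (u y) = 0 := fun y hy k => by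
    rw [ip_pd_of_const hu.contDiffOn_tension hu.smooth (fun z hz => hu.tension_ip_self hz) hy,
      hu.tension_ip_pd hy, neg_zero]
  have h1 : ∀ i j, ip (pd i (pd j (tension u)) x) (u x) = ip (pd i (pd j u) x) (tension u x) := by
    intro i j
    rw [ip_pd_of_const (contDiffOn_pd hu.contDiffOn_tension) hu.smooth (fun z hz => h0 z hz j) hx,
      ip_pd_of_const hu.contDiffOn_tension (contDiffOn_pd hu.smooth)
        (fun z hz => hu.tension_ip_pd hz i) hx, neg_neg, ip_comm,
        pd_pd_comm (hu.smooth.contDiffAt (s.isOpen.mem_nhds hx))]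
  have h2 : ip (lap u (tension u) x) (u x) = ip (lap u u x) (tension u x) := by
    simp only [lap, ip_sum_left, ip_smul_left, ip_sub_left, h1, h0 x hx,
      ip_comm (pd _ u x) (tension u x), hu.tension_ip_pd hx]
  have h3 : lap u u x = tension u x + (2 : ℝ) • u x := by rw [hu.tension_eq hx]; module
  rw [h2, h3, ip_add_left, ip_smul_left, ip_comm (u x), hu.tension_ip_self hx]
  ring

/-- Since the tension is normal to the surface, the second tension reduces to the Laplacian of
the tension in `R⁴₂`. -/
theorem bitension_eq {x : Plane} (hx : x ∈ s) :
    bitension u x = lap u (tension u) x + ip (tension u x) (tension u x) • u x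
      - (2 : ℝ) • tension u x := by
  rw [bitension, hu.traceLaplacian_eq hu.contDiffOn_tension (fun y hy => hu.tension_ip_self hy)
    (fun y hy l => hu.tension_ip_pd hy l) hx, hu.lap_tension_ip_self hx]
  congr 1
  rw [← hu.inv_contract hx, Finset.sum_smul]
  refine Finset.sum_congr rfl fun i _ => ?_
  rw [Finset.sum_smul]
  refine Finset.sum_congr rfl fun j _ => ?_
  have : ip (pd i u x) (pd j u x) = gram u x i j := rfl
  rw [curv, hu.tension_ip_pd hx, this]
  module

end LocalImmersion

end Coordinates

/-! ### Orthonormal frames of a space-like surface -/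

section LocalTheory

open TopologicalSpace (Opens)
open SmoothRing

namespace SmoothRing

variable {s : Opens Plane}

/-- The vector with coefficients in the ring of smooth functions defined by a smooth map to
`R⁴₂`. -/
def vecOf (V : Plane → Fin 4 → ℝ) (hV : ContDiffOn ℝ ∞ V s) : Fin 4 → SmoothRing s :=
  fun k => of (fun x => V x k) (contDiffOn_pi.1 hV k)

theorem ipA_vecOf {V W : Plane → Fin 4 → ℝ} (hV : ContDiffOn ℝ ∞ V s) (hW : ContDiffOn ℝ ∞ W s)
    (x : s) : (ipA (vecOf V hV) (vecOf W hW)).1 x = ip (V x) (W x) := rfl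

theorem partialD_vecOf {V : Plane → Fin 4 → ℝ} (hV : ContDiffOn ℝ ∞ V s) (i : Fin 2) (k : Fin 4) :
    partialD i (vecOf V hV k) = vecOf (pd i V) (contDiffOn_pd hV) k := by
  refine ext_ev fun x => ?_
  rw [partialD_apply i (g := fun y => V y k) (fun _ => rfl)]
  exact (pd_apply (LocalImmersion.differentiableAt hV x.2) k).symm

variable {g : Fin 2 → Fin 2 → SmoothRing s} {X Y : Fin 2 → SmoothRing s}

/-- Completeness of an orthonormal frame of the tangent plane: the matrix of the frame vectors and
that of their metric duals, inverse to each other by orthonormality, are also inverse in the other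
order. -/
theorem frame_completeness (hX : form g X X = 1) (hXY : form g X Y = 0) (hY : form g Y Y = 1) :
    ((g 0 0 * X 0 + g 0 1 * X 1) * X 0 + (g 0 0 * Y 0 + g 0 1 * Y 1) * Y 0 = 1 ∧
      (g 0 0 * X 0 + g 0 1 * X 1) * X 1 + (g 0 0 * Y 0 + g 0 1 * Y 1) * Y 1 = 0) ∧
    ((g 0 1 * X 0 + g 1 1 * X 1) * X 0 + (g 0 1 * Y 0 + g 1 1 * Y 1) * Y 0 = 0 ∧
      (g 0 1 * X 0 + g 1 1 * X 1) * X 1 + (g 0 1 * Y 0 + g 1 1 * Y 1) * Y 1 = 1) := by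
  let P : Matrix (Fin 2) (Fin 2) (SmoothRing s) := !![X 0, X 1; Y 0, Y 1]
  let Q : Matrix (Fin 2) (Fin 2) (SmoothRing s) :=
    !![g 0 0 * X 0 + g 0 1 * X 1, g 0 0 * Y 0 + g 0 1 * Y 1;
      g 0 1 * X 0 + g 1 1 * X 1, g 0 1 * Y 0 + g 1 1 * Y 1]
  have hPQ : P * Q = 1 := by
    simp only [form] at *
    ext1 i j
    fin_cases i <;> fin_cases j <;> simp only [P, Q, Matrix.mul_apply, Fin.sum_univ_two] <;> simp
    · linear_combination hX
    · linear_combination hXY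
    · linear_combination hXY
    · linear_combination hY
  have hQP : Q * P = 1 := mul_eq_one_comm.1 hPQ
  have e : ∀ i j, (Q * P) i j = (1 : Matrix (Fin 2) (Fin 2) (SmoothRing s)) i j := fun i j => by
    rw [hQP]
  have e00 := e 0 0
  have e01 := e 0 1
  have e10 := e 1 0
  have e11 := e 1 1
  simp only [P, Q, Matrix.mul_apply, Fin.sum_univ_two] at e00 e01 e10 e11
  simp at e00 e01 e10 e11
  exact ⟨⟨e00, e01⟩, e10, e11⟩

theorem exists_frame_coeff (hX : form g X X = 1) (hXY : form g X Y = 0) (hY : form g Y Y = 1)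
    (W : Fin 2 → SmoothRing s) :
    ∃ p q, W 0 = p * X 0 + q * Y 0 ∧ W 1 = p * X 1 + q * Y 1 := by
  obtain ⟨⟨e00, e01⟩, e10, e11⟩ := frame_completeness hX hXY hY
  refine ⟨form g W X, form g W Y, ?_, ?_⟩ <;> simp only [form]
  · linear_combination -W 0 * e00 - W 1 * e10
  · linear_combination -W 0 * e01 - W 1 * e11

/-- The partial derivatives are combinations of the derivatives along an orthonormal frame. -/
theorem partialD_mem_span (hX : form g X X = 1) (hXY : form g X Y = 0) (hY : form g Y Y = 1)
    (i : Fin 2) : ∃ p q, ∀ f, partialD i f = p * dir X f + q * dir Y f := by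
  obtain ⟨p, q, h0, h1⟩ := exists_frame_coeff hX hXY hY (Pi.single i 1)
  refine ⟨p, q, fun f => ?_⟩
  simp only [dir_apply]
  fin_cases i <;> simp at h0 h1 ⊢
  · linear_combination partialD 0 f * h0 + partialD 1 f * h1
  · linear_combination partialD 0 f * h0 + partialD 1 f * h1

theorem exists_bracket_coeff (hX : form g X X = 1) (hXY : form g X Y = 0) (hY : form g Y Y = 1) :
    ∃ l m, ∀ f, dir X (dir Y f) - dir Y (dir X f) = l * dir X f + m * dir Y f := by
  obtain ⟨p, q, h0, h1⟩ := exists_frame_coeff hX hXY hY (fun k => dir X (Y k) - dir Y (X k))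
  refine ⟨p, q, fun f => ?_⟩
  have e : dir X (dir Y f) - dir Y (dir X f) =
      (dir X (Y 0) - dir Y (X 0)) * partialD 0 f + (dir X (Y 1) - dir Y (X 1)) * partialD 1 f := by
    simp only [dir_apply, map_add, Derivation.leibniz, smul_eq_mul, partialD_comm 1 0 f]
    ring
  rw [e, h0, h1, dir_apply X f, dir_apply Y f]
  ring

/-- In terms of an orthonormal frame, a second order operator with the inverse metric as its
principal part is the sum of the squares of the frame, up to terms of first order. -/
theorem exists_laplacian_coeff (hX : form g X X = 1) (hXY : form g X Y = 0) (hY : form g Y Y = 1)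
    (hg : g 1 0 = g 0 1) {G : Fin 2 → Fin 2 → SmoothRing s}
    (hG : ∀ i j, G i 0 * g 0 j + G i 1 * g 1 j = if i = j then 1 else 0)
    (T : Fin 2 → SmoothRing s) :
    ∃ p q, ∀ f, ∑ i, ∑ j, G i j * partialD i (partialD j f) - ∑ k, T k * partialD k f =
      dir X (dir X f) + dir Y (dir Y f) - p * dir X f - q * dir Y f := by
  obtain ⟨⟨e00, e01⟩, e10, e11⟩ := frame_completeness hX hXY hY
  have h00 := hG 0 0
  have h01 := hG 0 1
  have h10 := hG 1 0
  have h11 := hG 1 1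
  rw [hg] at h00 h10
  simp at h00 h01 h10 h11
  have g00 : G 0 0 = X 0 * X 0 + Y 0 * Y 0 := by
    linear_combination (X 0 * X 0 + Y 0 * Y 0) * h00 + (X 1 * X 0 + Y 1 * Y 0) * h01
      - G 0 0 * e00 - G 0 1 * e10
  have g01 : G 0 1 = X 0 * X 1 + Y 0 * Y 1 := by
    linear_combination (X 0 * X 1 + Y 0 * Y 1) * h00 + (X 1 * X 1 + Y 1 * Y 1) * h01
      - G 0 0 * e01 - G 0 1 * e11
  have g10 : G 1 0 = X 1 * X 0 + Y 1 * Y 0 := by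
    linear_combination (X 0 * X 0 + Y 0 * Y 0) * h10 + (X 1 * X 0 + Y 1 * Y 0) * h11
      - G 1 0 * e00 - G 1 1 * e10
  have g11 : G 1 1 = X 1 * X 1 + Y 1 * Y 1 := by
    linear_combination (X 0 * X 1 + Y 0 * Y 1) * h10 + (X 1 * X 1 + Y 1 * Y 1) * h11
      - G 1 0 * e01 - G 1 1 * e11
  obtain ⟨p, q, h0, h1⟩ :=
    exists_frame_coeff hX hXY hY (fun k => dir X (X k) + dir Y (Y k) + T k)
  refine ⟨p, q, fun f => ?_⟩
  have e : dir X (dir X f) + dir Y (dir Y f) = ∑ i, ∑ j, G i j * partialD i (partialD j f)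
      + ((dir X (X 0) + dir Y (Y 0)) * partialD 0 f
        + (dir X (X 1) + dir Y (Y 1)) * partialD 1 f) := by
    simp only [dir_apply, map_add, Derivation.leibniz, smul_eq_mul, Fin.sum_univ_two, g00, g01,
      g10, g11]
    ring
  rw [e, dir_apply X f, dir_apply Y f, Fin.sum_univ_two (f := fun k => T k * partialD k f)]
  linear_combination -partialD 0 f * h0 - partialD 1 f * h1

end SmoothRing

/-- The normal space of a space-like surface in `R⁴₂` is negative definite. -/
theorem ip_self_neg {v w n : Fin 4 → ℝ}
    (hpos : ∀ a b : ℝ, a ≠ 0 ∨ b ≠ 0 → 0 < ip (a • v + b • w) (a • v + b • w))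
    (hv : ip n v = 0) (hw : ip n w = 0) (hn : n ≠ 0) : ip n n < 0 := by
  by_contra! h
  -- a combination of `v, w, n` whose first two coordinates vanish is not space-like
  let A : Matrix (Fin 2) (Fin 3) ℝ := !![v 0, w 0, n 0; v 1, w 1, n 1]
  obtain ⟨c, hc, hc0⟩ := (Submodule.ne_bot_iff _).1
    (LinearMap.ker_ne_bot_of_finrank_lt (f := A.mulVecLin) (by simp))
  rw [LinearMap.mem_ker] at hc
  have c0 := congrFun hc 0
  have c1 := congrFun hc 1
  simp [A, Matrix.mulVec, dotProduct, Fin.sum_univ_three] at c0 c1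
  have hq : ip (c 0 • v + c 1 • w + c 2 • n) (c 0 • v + c 1 • w + c 2 • n)
      = ip (c 0 • v + c 1 • w) (c 0 • v + c 1 • w) + c 2 * c 2 * ip n n := by
    simp only [ip, Pi.add_apply, Pi.smul_apply, smul_eq_mul] at *
    linear_combination 2 * c 2 * c 0 * hv + 2 * c 2 * c 1 * hw
  have hle : ip (c 0 • v + c 1 • w + c 2 • n) (c 0 • v + c 1 • w + c 2 • n) =
      -((c 0 * v 2 + c 1 * w 2 + c 2 * n 2) ^ 2 + (c 0 * v 3 + c 1 * w 3 + c 2 * n 3) ^ 2) := by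
    simp only [ip, Pi.add_apply, Pi.smul_apply, smul_eq_mul]
    linear_combination (c 0 * v 0 + c 1 * w 0 + c 2 * n 0) * c0
      + (c 0 * v 1 + c 1 * w 1 + c 2 * n 1) * c1
  have h2 : 0 ≤ c 2 * c 2 * ip n n := mul_nonneg (mul_self_nonneg _) h
  by_cases h01 : c 0 ≠ 0 ∨ c 1 ≠ 0
  · have := hpos _ _ h01
    nlinarith [sq_nonneg (c 0 * v 2 + c 1 * w 2 + c 2 * n 2),
      sq_nonneg (c 0 * v 3 + c 1 * w 3 + c 2 * n 3)]
  · push Not at h01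
    obtain ⟨z0, z1⟩ := h01
    simp only [z0, z1, zero_mul, zero_add, mul_zero, zero_smul] at c0 c1 hq hle
    have z2 : c 2 ≠ 0 := by
      intro z2
      apply hc0
      ext i; fin_cases i <;> simp [z0, z1, z2]
    have hz : ip (0 : Fin 4 → ℝ) 0 = 0 := by simp [ip]
    rw [hz] at hq
    have k2 : c 2 * n 2 = 0 := by nlinarith [sq_nonneg (c 2 * n 2), sq_nonneg (c 2 * n 3)]
    have k3 : c 2 * n 3 = 0 := by nlinarith [sq_nonneg (c 2 * n 2), sq_nonneg (c 2 * n 3)]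
    apply hn
    ext i
    fin_cases i
    exacts [(mul_eq_zero.1 c0).resolve_right z2, (mul_eq_zero.1 c1).resolve_right z2,
      (mul_eq_zero.1 k2).resolve_left z2, (mul_eq_zero.1 k3).resolve_left z2]

namespace LocalImmersion

variable {s : Opens Plane} {u : Plane → Fin 4 → ℝ} (hu : LocalImmersion s u)
include hu

theorem normal_neg {x : Plane} (hx : x ∈ s) {n : Fin 4 → ℝ} (h : ∀ i, ip n (pd i u x) = 0)
    (hn : n ≠ 0) : ip n n < 0 := by
  refine ip_self_neg (fun a b hab => ?_) (h 0) (h 1) hn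
  have := hu.spacelike x hx (!₂[a, b]) (by
    intro h0
    have e0 := congrArg (fun v : Plane => v 0) h0
    have e1 := congrArg (fun v : Plane => v 1) h0
    simp at e0 e1
    tauto)
  rw [fderiv_eq_pd] at this
  simpa using this

/-- The coefficients of the first fundamental form as elements of the ring of smooth
functions. -/
def metric (i j : Fin 2) : SmoothRing s := of (fun x => gram u x i j) (hu.contDiffOn_gram i j)

theorem exists_frame (Z : Fin 2 → SmoothRing s) (hZ : ∀ x : s, (Z 0).1 x ≠ 0 ∨ (Z 1).1 x ≠ 0) :
    ∃ (r : SmoothRing s) (Y : Fin 2 → SmoothRing s), form hu.metric (r • Z) (r • Z) = 1 ∧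
      form hu.metric (r • Z) Y = 0 ∧ form hu.metric Y Y = 1 :=
  exists_orthonormal (g := hu.metric) (fun x => hu.gram_pos x.2) (fun x => hu.gram_det_pos x.2) Z hZ

/-- Where the tension does not vanish, it is the product of a positive function and a unit normal
field. -/
theorem exists_meanCurvature (hτ : ∀ x ∈ s, tension u x ≠ 0) :
    ∃ (H : SmoothRing s) (n : Fin 4 → SmoothRing s), (∀ x : s, H.1 x ≠ 0) ∧
      (H * H = -ipA (vecOf (tension u) hu.contDiffOn_tension)
        (vecOf (tension u) hu.contDiffOn_tension)) ∧
      ∀ k, H * n k = vecOf (tension u) hu.contDiffOn_tension k := by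
  obtain ⟨H, hH, hpos⟩ := exists_sqrt (s := s) (f := -ipA (vecOf (tension u) hu.contDiffOn_tension)
        (vecOf (tension u) hu.contDiffOn_tension)) (fun x =>
      neg_pos.2 (hu.normal_neg x.2 (hu.tension_ip_pd x.2) (hτ x x.2)))
  obtain ⟨r, hr⟩ := (isUnit_of_ne_zero fun x => (hpos x).ne').exists_right_inv
  refine ⟨H, fun k => r * vecOf (tension u) hu.contDiffOn_tension k, fun x => (hpos x).ne', hH,
    fun k => ?_⟩
  linear_combination vecOf (tension u) hu.contDiffOn_tension k * hr

/-- The Laplacian in terms of the derivations `partialD` of the ring of smooth functions. -/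
theorem vecOf_lap {V : Plane → Fin 4 → ℝ} (hV : ContDiffOn ℝ ∞ V s) (k : Fin 4) :
    vecOf (lap u V) (hu.contDiffOn_lap hV) k =
      ∑ i, ∑ j, of (fun x => (gram u x)⁻¹ i j) (hu.contDiffOn_inv i j) *
        partialD i (partialD j (vecOf V hV k))
      - ∑ l, (∑ i, ∑ j, of (fun x => (gram u x)⁻¹ i j) (hu.contDiffOn_inv i j) *
        of (christoffel u l i j) (hu.contDiffOn_christoffel l i j)) *
          partialD l (vecOf V hV k) := by
  refine ext_ev fun x => ?_
  simp only [partialD_vecOf, ← ev_apply, map_sub, map_sum, map_mul]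
  simp only [ev_apply, of_apply, vecOf, lap, Finset.sum_apply, Pi.sub_apply, Pi.smul_apply,
    smul_eq_mul, Fin.sum_univ_two, Pi.add_apply]
  ring

/-- Every orthonormal tangent frame `X, Y` of a biharmonic surface without zeros of the tension
satisfies the structure equations `BiharmonicFrame`. -/
theorem exists_biharmonicFrame (hbi : ∀ x ∈ s, bitension u x = 0) {H : SmoothRing s}
    {n : Fin 4 → SmoothRing s} (hH0 : ∀ x : s, H.1 x ≠ 0)
    (hH : H * H = -ipA (vecOf (tension u) hu.contDiffOn_tension)
        (vecOf (tension u) hu.contDiffOn_tension))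
    (hn : ∀ k, H * n k = vecOf (tension u) hu.contDiffOn_tension k)
    {X Y : Fin 2 → SmoothRing s} (hX : form hu.metric X X = 1) (hXY : form hu.metric X Y = 0)
    (hY : form hu.metric Y Y = 1) :
    ∃ α β a b c, BiharmonicFrame (dir X) (dir Y) H α β a b c ∧
      dv (dir X) n = a • dv (dir X) (vecOf u hu.smooth) + b • dv (dir Y) (vecOf u hu.smooth) ∧
      dv (dir Y) n = b • dv (dir X) (vecOf u hu.smooth) + c • dv (dir Y) (vecOf u hu.smooth) := by
  set U := vecOf u hu.smooth with hU
  set τ := vecOf (tension u) hu.contDiffOn_tension with hτ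
  have hHu : IsUnit H := isUnit_of_ne_zero hH0
  obtain ⟨l, m, hbr⟩ := exists_bracket_coeff hX hXY hY
  have hg : hu.metric 1 0 = hu.metric 0 1 := ext_ev fun x => gram_symm u x 1 0
  have hG : ∀ i j, of (fun x => (gram u x)⁻¹ i 0) (hu.contDiffOn_inv i 0) * hu.metric 0 j
      + of (fun x => (gram u x)⁻¹ i 1) (hu.contDiffOn_inv i 1) * hu.metric 1 j
        = if i = j then 1 else 0 := by
    refine fun i j => ext_ev fun x => ?_
    have := hu.inv_mul x.2 i j
    rw [Fin.sum_univ_two] at this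
    refine Eq.trans ?_ (this.trans ?_)
    · rfl
    · split_ifs <;> rfl
  obtain ⟨p, q, hlap⟩ := exists_laplacian_coeff hX hXY hY hg
    (G := fun i j => of (fun x => (gram u x)⁻¹ i j) (hu.contDiffOn_inv i j)) hG
    (fun l => ∑ i, ∑ j, of (fun x => (gram u x)⁻¹ i j) (hu.contDiffOn_inv i j) *
        of (christoffel u l i j) (hu.contDiffOn_christoffel l i j))
  have hUU : ipA U U = -1 := ext_ev fun x => hu.mem_adS x x.2
  have hτU : ipA τ U = 0 := ext_ev fun x => hu.tension_ip_self x.2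
  have hdir : ∀ Z : Fin 2 → SmoothRing s, dv (dir Z) U =
      Z 0 • vecOf (pd 0 u) (contDiffOn_pd hu.smooth)
        + Z 1 • vecOf (pd 1 u) (contDiffOn_pd hu.smooth) := by
    intro Z; ext1 k
    simp only [dv, dir_apply, hU, partialD_vecOf]; rfl
  have hform : ∀ Z W : Fin 2 → SmoothRing s,
      ipA (dv (dir Z) U) (dv (dir W) U) = form hu.metric Z W := by
    intro Z W
    have h0 : ipA (vecOf (pd 0 u) (contDiffOn_pd hu.smooth))
      (vecOf (pd 0 u) (contDiffOn_pd hu.smooth)) = hu.metric 0 0 := rfl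
    have h1 : ipA (vecOf (pd 0 u) (contDiffOn_pd hu.smooth))
      (vecOf (pd 1 u) (contDiffOn_pd hu.smooth)) = hu.metric 0 1 := rfl
    have h2 : ipA (vecOf (pd 1 u) (contDiffOn_pd hu.smooth))
      (vecOf (pd 1 u) (contDiffOn_pd hu.smooth)) = hu.metric 1 1 := rfl
    rw [hdir, hdir, form, ← h0, ← h1, ← h2]
    simp only [ipA, Pi.add_apply, Pi.smul_apply, smul_eq_mul]
    ring
  have hτe : ∀ Z : Fin 2 → SmoothRing s, ipA τ (dv (dir Z) U) = 0 := by
    intro Z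
    have h0 : ipA (vecOf (pd 0 u) (contDiffOn_pd hu.smooth)) τ = 0 :=
      ext_ev fun x => (ip_comm _ _).trans (hu.tension_ip_pd x.2 0)
    have h1 : ipA (vecOf (pd 1 u) (contDiffOn_pd hu.smooth)) τ = 0 :=
      ext_ev fun x => (ip_comm _ _).trans (hu.tension_ip_pd x.2 1)
    rw [ipA_comm, hdir, ipA_add_left, ipA_smul_left, ipA_smul_left, h0, h1]
    ring
  have hτn : τ = H • n := by ext1 k; exact (hn k).symm
  have hτ2 : ∀ k, vecOf (lap u u) (hu.contDiffOn_lap hu.smooth) k - 2 * U k = τ k := by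
    intro k
    refine ext_ev fun x => ?_
    simp only [← ev_apply, map_sub, map_mul, map_ofNat]
    exact (congrFun (hu.tension_eq x.2) k).symm
  have hbi2 : ∀ k, vecOf (lap u (tension u)) (hu.contDiffOn_lap hu.contDiffOn_tension) k
      = 2 * τ k + H * H * U k := by
    intro k
    refine ext_ev fun x => ?_
    have := congrFun ((hu.bitension_eq x.2).symm.trans (hbi x x.2)) k
    rw [hH]
    simp only [← ev_apply, map_add, map_neg, map_mul, map_ofNat]
    simp only [ev_apply, hτ, hU, ipA_vecOf, vecOf, of_apply]
    simp only [Pi.sub_apply, Pi.add_apply, Pi.smul_apply, smul_eq_mul, Pi.zero_apply] at this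
    linear_combination this
  refine AntiDeSitter.exists_biharmonicFrame (l := l) (m := m) (p := p) (q := q) hbr hUU
    ((hform X X).trans hX) ((hform Y Y).trans hY) ((hform X Y).trans hXY) ?_ ?_ ?_ ?_ ?_ ?_
    isUnit_two
  · refine (hHu.mul hHu).mul_left_cancel ?_
    have : ipA τ τ = H * H * ipA n n := by
      rw [hτn, ipA_smul_left, ipA_comm, ipA_smul_left]; ring
    rw [← this]
    linear_combination hH
  · refine hHu.mul_left_cancel ?_
    rw [← ipA_smul_left, ← hτn, hτU, mul_zero]
  · refine hHu.mul_left_cancel ?_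
    rw [← ipA_smul_left, ← hτn, hτe, mul_zero]
  · refine hHu.mul_left_cancel ?_
    rw [← ipA_smul_left, ← hτn, hτe, mul_zero]
  · intro k
    rw [← hlap (U k), hn k, ← hτ2 k, hu.vecOf_lap]
  · intro k
    rw [hn k, ← hlap (τ k), ← hbi2 k, hu.vecOf_lap]

end LocalImmersion

end LocalTheory

/-! ### Biharmonic surfaces are locally maximal or totally umbilical -/

section LocalTheorem

open TopologicalSpace (Opens)
open SmoothRing

namespace LocalImmersion

variable {s : Opens Plane} {u : Plane → Fin 4 → ℝ} (hu : LocalImmersion s u)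
include hu

/-- The square of the mean curvature of a biharmonic surface has no gradient: near a point with a
nonzero gradient, an orthonormal frame with first vector tangent to the level lines of the mean
curvature would contradict `BiharmonicFrame.not_gradient`. -/
theorem pd_ip_tension (hbi : ∀ x ∈ s, bitension u x = 0) {x : Plane} (hx : x ∈ s) (i : Fin 2) :
    pd i (fun y => ip (tension u y) (tension u y)) x = 0 := by
  by_contra hne
  set f : Plane → ℝ := fun y => ip (tension u y) (tension u y) with hf
  have hfs : ContDiffOn ℝ ∞ f s := contDiffOn_ip hu.contDiffOn_tension hu.contDiffOn_tension
  have hfx : f x ≠ 0 := by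
    intro h0
    have hτ0 : tension u x = 0 := by
      by_contra h
      exact (hu.normal_neg hx (hu.tension_ip_pd hx) h).ne h0
    apply hne
    have hd := differentiableAt hu.contDiffOn_tension hx
    rw [hf, pd_ip i hd hd, hτ0]
    simp [ip]
  have hcont : ContinuousOn (fun y => f y * pd i f y) s :=
    hfs.continuousOn.mul (contDiffOn_pd hfs).continuousOn
  let t : Opens Plane :=
    ⟨s ∩ (fun y => f y * pd i f y) ⁻¹' {0}ᶜ,
      hcont.isOpen_inter_preimage s.isOpen isOpen_compl_singleton⟩
  have hts : t ≤ s := fun y hy => hy.1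
  have hxt : x ∈ t := ⟨hx, mul_ne_zero hfx hne⟩
  have ht : ∀ y ∈ t, f y ≠ 0 ∧ pd i f y ≠ 0 := fun y hy => mul_ne_zero_iff.1 hy.2
  have hut := hu.mono hts
  obtain ⟨H, n, hH0, hH, hn⟩ := hut.exists_meanCurvature (fun y hy h => (ht y hy).1 (by
    simp [hf, h, ip]))
  have hHu : IsUnit H := isUnit_of_ne_zero hH0
  have hHi : ∀ y : t, (partialD i H).1 y ≠ 0 := by
    intro y h
    have h1 := congrArg (partialD i) hH
    have h2 : (partialD i (-ipA (vecOf (tension u) hut.contDiffOn_tension)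
        (vecOf (tension u) hut.contDiffOn_tension))).1 y = -pd i f y := by
      rw [map_neg]
      exact congrArg Neg.neg (partialD_apply i (g := f) (fun _ => rfl) y)
    rw [Derivation.leibniz, smul_eq_mul] at h1
    rw [← h1, ← ev_apply, map_add, map_mul, ev_apply, ev_apply, h, mul_zero, add_zero] at h2
    exact (ht y y.2).2 (neg_eq_zero.1 h2.symm)
  obtain ⟨r, Y, hX, hXY, hY⟩ := hut.exists_frame ![-partialD 1 H, partialD 0 H] (fun y => by
    have := hHi y
    fin_cases i
    · exact Or.inr this
    · refine Or.inl fun h => this ?_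
      have h' : ev y (-partialD 1 H) = 0 := h
      rw [map_neg, neg_eq_zero] at h'
      exact h')
  obtain ⟨α, β, a, b, c, F, -⟩ := hut.exists_biharmonicFrame (fun y hy => hbi y (hts hy))
    hH0 hH hn hX hXY hY
  have h1 : dir (r • ![-partialD 1 H, partialD 0 H]) H = 0 := by
    rw [dir_apply]; simp; ring
  obtain ⟨p, q, hpq⟩ := partialD_mem_span hX hXY hY i
  refine F.not_gradient isUnit_two hHu h1 (isUnit_of_ne_zero fun y hy => hHi y ?_) (ev ⟨x, hxt⟩)
  rw [hpq, h1, ← ev_apply, map_add, map_mul, map_mul, ev_apply y (dir Y H), hy, map_zero,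
    mul_zero, mul_zero, add_zero]

/-- Where the mean curvature of a biharmonic surface is a nonzero constant, the surface is totally
umbilical with `⟨τ, τ⟩ = -4`, and the point `u - τ / 2` does not move. -/
theorem umbilical (hbi : ∀ x ∈ s, bitension u x = 0) (hτ : ∀ x ∈ s, tension u x ≠ 0)
    {x : Plane} (hx : x ∈ s) : ip (tension u x) (tension u x) = -4 ∧
      ∀ i, pd i (fun y => u y - (1 / 2 : ℝ) • tension u y) x = 0 := by
  obtain ⟨H, n, hH0, hH, hn⟩ := hu.exists_meanCurvature hτ
  have hHu : IsUnit H := isUnit_of_ne_zero hH0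
  have half : ∀ x : SmoothRing s, x + x = 0 → x = 0 := fun x hx =>
    isUnit_two.mul_left_cancel (by rw [two_mul, hx, mul_zero])
  have hHi : ∀ i, partialD i H = 0 := by
    intro i
    refine half _ (hHu.mul_left_cancel ?_)
    have h1 := congrArg (partialD i) hH
    have h2 : partialD i (ipA (vecOf (tension u) hu.contDiffOn_tension)
        (vecOf (tension u) hu.contDiffOn_tension)) = 0 :=
      ext_ev fun y => (partialD_apply i (fun _ => rfl) y).trans (hu.pd_ip_tension hbi y.2 i)
    rw [Derivation.leibniz, smul_eq_mul, map_neg, h2] at h1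
    linear_combination h1
  have hHd : ∀ Z : Fin 2 → SmoothRing s, dir Z H = 0 := by
    intro Z; rw [dir_apply, hHi, hHi, mul_zero, mul_zero, add_zero]
  obtain ⟨r, Y, hX, hXY, hY⟩ := hu.exists_frame ![1, 0] (fun y => Or.inl one_ne_zero)
  obtain ⟨α, β, a, b, c, F, hn1, hn2⟩ := hu.exists_biharmonicFrame hbi hH0 hH hn hX hXY hY
  have key := fun y => F.umbilical isUnit_two hHu (hHd _) (hHd _) (ev y)
  have hHH : H * H = 4 := ext_ev fun y => by
    rw [← ev_apply, ← ev_apply, map_mul, map_ofNat]; exact (key y).1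
  have hb : b = 0 := ext_ev fun y => (key y).2.1
  have ha : 2 * a = H := ext_ev fun y => by
    rw [← ev_apply, ← ev_apply, map_mul, map_ofNat]; exact (key y).2.2.1
  have hc : 2 * c = H := ext_ev fun y => by
    rw [← ev_apply, ← ev_apply, map_mul, map_ofNat]; exact (key y).2.2.2
  constructor
  · have h := congrArg (ev ⟨x, hx⟩) hH
    rw [hHH, map_neg, map_ofNat] at h
    have h' : ev ⟨x, hx⟩ (ipA (vecOf (tension u) hu.contDiffOn_tension)
        (vecOf (tension u) hu.contDiffOn_tension)) = ip (tension u x) (tension u x) := rfl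
    rw [h'] at h
    linarith
  · intro i
    obtain ⟨p, q, hpq⟩ := partialD_mem_span hX hXY hY i
    have e1 : ∀ k, 2 * dir (r • ![1, 0]) (vecOf u hu.smooth k)
        = dir (r • ![1, 0]) (vecOf (tension u) hu.contDiffOn_tension k) := by
      intro k
      rw [← hn k, Derivation.leibniz, hHd, smul_zero, add_zero, smul_eq_mul]
      have e := congrFun hn1 k
      simp only [dv, hb, zero_smul, add_zero, Pi.smul_apply, smul_eq_mul] at e
      rw [e]
      refine isUnit_two.mul_left_cancel ?_
      linear_combination (-dir (r • ![1, 0]) (vecOf u hu.smooth k)) * (hHH + H * ha)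
    have e2 : ∀ k, 2 * dir Y (vecOf u hu.smooth k)
        = dir Y (vecOf (tension u) hu.contDiffOn_tension k) := by
      intro k
      rw [← hn k, Derivation.leibniz, hHd, smul_zero, add_zero, smul_eq_mul]
      have e := congrFun hn2 k
      simp only [dv, hb, zero_smul, Pi.smul_apply, Pi.add_apply, Pi.zero_apply, zero_add,
        smul_eq_mul] at e
      rw [e]
      refine isUnit_two.mul_left_cancel ?_
      linear_combination (-dir Y (vecOf u hu.smooth k)) * (hHH + H * hc)
    have e3 : ∀ k, 2 * partialD i (vecOf u hu.smooth k)
        = partialD i (vecOf (tension u) hu.contDiffOn_tension k) := by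
      intro k
      rw [hpq, hpq]
      linear_combination p * e1 k + q * e2 k
    ext k
    have e4 := congrArg (ev ⟨x, hx⟩) (e3 k)
    rw [partialD_vecOf, partialD_vecOf, map_mul, map_ofNat] at e4
    have e5 : 2 * pd i u x k = pd i (tension u) x k := e4
    have hd := differentiableAt hu.contDiffOn_tension hx
    have hd' := differentiableAt hu.smooth hx
    have e6 : pd i (fun y => u y - (1 / 2 : ℝ) • tension u y) x =
        pd i u x - (1 / 2 : ℝ) • pd i (tension u) x := by
      have h := (hd'.hasFDerivAt.sub (hd.hasFDerivAt.const_smul (1 / 2 : ℝ))).fderiv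
      exact congrArg (· (EuclideanSpace.single i 1)) h
    rw [e6]
    simp only [Pi.sub_apply, Pi.smul_apply, smul_eq_mul, Pi.zero_apply]
    linarith

/-- Near each of its points, a biharmonic surface is maximal, or it is umbilical with the constant
centre `c = u - τ / 2`. -/
theorem maximal_or_umbilical (hbi : ∀ x ∈ s, bitension u x = 0) {x : Plane} (hx : x ∈ s) :
    (∀ᶠ y in 𝓝 x, tension u y = 0) ∨
      ∃ c, ∀ᶠ y in 𝓝 x, u y - (1 / 2 : ℝ) • tension u y = c ∧
        ip (tension u y) (tension u y) = -4 := by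
  obtain ⟨ε, hε, hball⟩ := Metric.isOpen_iff.1 s.isOpen x hx
  have hconst : ∀ {F : Type} [NormedAddCommGroup F] [NormedSpace ℝ F] (f : Plane → F),
      ContDiffOn ℝ ∞ f s → (∀ y ∈ Metric.ball x ε, ∀ i, pd i f y = 0) →
      ∀ y ∈ Metric.ball x ε, f y = f x := by
    intro F _ _ f hf h0 y hy
    refine (convex_ball x ε).is_const_of_fderivWithin_eq_zero (𝕜 := ℝ)
      ((hf.differentiableOn (by simp)).mono hball) (fun z hz => ?_) hy (Metric.mem_ball_self hε)
    rw [fderivWithin_of_isOpen Metric.isOpen_ball hz]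
    ext1 v
    simp [fderiv_eq_pd, h0 z hz]
  have hf := hconst _ (contDiffOn_ip hu.contDiffOn_tension hu.contDiffOn_tension)
    (fun y hy i => hu.pd_ip_tension hbi (hball hy) i)
  have hmem : Metric.ball x ε ∈ 𝓝 x := Metric.ball_mem_nhds x hε
  by_cases h0 : ip (tension u x) (tension u x) = 0
  · refine Or.inl (mem_of_superset hmem fun y hy => ?_)
    by_contra h
    exact (hu.normal_neg (hball hy) (hu.tension_ip_pd (hball hy)) h).ne ((hf y hy).trans h0)
  · let t : Opens Plane := ⟨Metric.ball x ε, Metric.isOpen_ball⟩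
    have hut : LocalImmersion t u := hu.mono (fun y hy => hball hy)
    have hτ : ∀ y ∈ t, tension u y ≠ 0 := by
      intro y hy h
      apply h0
      rw [← hf y hy]
      simp [h, ip]
    have key := fun y hy => hut.umbilical (fun z hz => hbi z (hball hz)) hτ (x := y) hy
    refine Or.inr ⟨_, mem_of_superset hmem fun y hy => ⟨hconst _ (hu.smooth.sub
      (hu.contDiffOn_tension.const_smul (1 / 2 : ℝ))) (fun z hz i => (key z hz).2 i) y hy,
      (key y hy).1⟩⟩

/-- A point `c` with `⟨c, u⟩ = -1` near `x` determines the tension in its direction. -/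
theorem ip_tension_of_const {c : Fin 4 → ℝ} {x : Plane} (hx : x ∈ s)
    (hc : ∀ᶠ y in 𝓝 x, ip c (u y) = -1) :
    (∀ i, ip c (pd i u x) = 0) ∧ ip (tension u x) c = 2 := by
  obtain ⟨t, ht, htopen, hxt⟩ := eventually_nhds_iff.1 hc
  let o : Opens Plane := s ⊓ ⟨t, htopen⟩
  have hxo : x ∈ o := ⟨hx, hxt⟩
  have huo : LocalImmersion o u := hu.mono inf_le_left
  have hcs : ContDiffOn ℝ ∞ (fun _ : Plane => c) o := contDiffOn_const
  have hpc : ∀ y i, pd i (fun _ : Plane => c) y = 0 := by intro y i; simp [pd]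
  have h0 : ∀ w : Fin 4 → ℝ, ip w 0 = 0 := by intro w; simp [ip]
  have h1 : ∀ y ∈ o, ∀ i, ip (pd i u y) c = 0 := by
    intro y hy i
    rw [ip_pd_of_const huo.smooth hcs (r := -1) (fun z hz => by rw [ip_comm]; exact ht z hz.2) hy,
      hpc, h0, neg_zero]
  have h2 : ∀ i j, ip (pd i (pd j u) x) c = 0 := by
    intro i j
    rw [ip_pd_of_const (contDiffOn_pd huo.smooth) hcs (r := 0) (fun z hz => h1 z hz j) hxo,
      hpc, h0, neg_zero]
  refine ⟨fun i => by rw [ip_comm]; exact h1 x hxo i, ?_⟩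
  rw [hu.tension_eq hx, ip_sub_left, ip_smul_left, ip_comm (u x), ht x hxt]
  simp only [lap, ip_sum_left, ip_smul_left, ip_sub_left, h2, h1 x hxo]
  simp

/-- The centre of an umbilical surface with `⟨τ, τ⟩ = -4` is unique. -/
theorem eq_center {c : Fin 4 → ℝ} (hcc : ip c c = -2) {x : Plane} (hx : x ∈ s)
    (hc : ∀ᶠ y in 𝓝 x, ip c (u y) = -1) (hτ : ip (tension u x) (tension u x) = -4) :
    u x - (1 / 2 : ℝ) • tension u x = c := by
  obtain ⟨h1, h2⟩ := hu.ip_tension_of_const hx hc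
  have h3 : ip (u x) (u x) = -1 := hu.mem_adS x hx
  have h4 := hu.tension_ip_self hx
  have h5 : ip c (u x) = -1 := hc.self_of_nhds
  by_contra hne
  -- the difference is a normal null vector
  refine (hu.normal_neg hx (n := (u x - (1 / 2 : ℝ) • tension u x) - c) (fun i => ?_)
    (sub_ne_zero.2 hne)).ne ?_
  · rw [ip_sub_left, ip_sub_left, ip_smul_left, h1, hu.tension_ip_pd hx, ip_comm,
      hu.ip_pd_self hx]
    ring
  · simp only [ip, Pi.sub_apply, Pi.smul_apply, smul_eq_mul] at *
    linear_combination h3 + (1 / 4) * hτ + hcc - h4 - 2 * h5 + h2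

end LocalImmersion

end LocalTheorem

/-! ### The centre of a proper biharmonic surface -/

section Center

open TopologicalSpace (Opens)

variable {M : Type*} [TopologicalSpace M] [ChartedSpace (EuclideanSpace ℝ (Fin 2)) M]

/-- The image of a chart. -/
def chartTarget (e : OpenPartialHomeomorph M Plane) : Opens Plane := ⟨e.target, e.open_target⟩

theorem fderiv_comp_chart_symm [IsManifold (𝓡 2) ∞ M] {E : Type*} [NormedAddCommGroup E]
    [NormedSpace ℝ E] {f : M → E} (hf : ContMDiff (𝓡 2) 𝓘(ℝ, E) ∞ f)
    {e : OpenPartialHomeomorph M Plane} (he : e ∈ atlas Plane M) {x : Plane} (hx : x ∈ e.target)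
    (v : Plane) : fderiv ℝ (f ∘ e.symm) x v =
      mfderiv (𝓡 2) 𝓘(ℝ, E) f (e.symm x) (mfderiv (𝓡 2) (𝓡 2) e.symm x v) := by
  have : IsManifold (𝓡 2) 1 M := .of_le (n := ∞) (by norm_cast)
  have hd := mdifferentiable_of_mem_atlas (I := 𝓡 2) he
  have h1 : MDifferentiableAt (𝓡 2) (𝓡 2) e.symm x := hd.symm.mdifferentiableAt hx
  have h2 : MDifferentiableAt (𝓡 2) 𝓘(ℝ, E) f (e.symm x) := hf.mdifferentiable (by simp) _
  rw [← mfderiv_eq_fderiv, mfderiv_comp x h2 h1]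
  rfl

theorem mfderiv_chart_symm_ne_zero [IsManifold (𝓡 2) ∞ M] {e : OpenPartialHomeomorph M Plane}
    (he : e ∈ atlas Plane M) {x : Plane} (hx : x ∈ e.target) {v : Plane} (hv : v ≠ 0) :
    mfderiv (𝓡 2) (𝓡 2) e.symm x v ≠ 0 := by
  have : IsManifold (𝓡 2) 1 M := .of_le (n := ∞) (by norm_cast)
  have hd := mdifferentiable_of_mem_atlas (I := 𝓡 2) he
  intro h0
  have h5 : mfderiv (𝓡 2) (𝓡 2) e (e.symm x) (mfderiv (𝓡 2) (𝓡 2) e.symm x v) = v :=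
    congrArg (fun f => f v) (hd.comp_symm_deriv hx)
  rw [h0, map_zero] at h5
  exact hv h5.symm

theorem contDiffOn_comp_chart_symm [IsManifold (𝓡 2) ∞ M] {E : Type*} [NormedAddCommGroup E]
    [NormedSpace ℝ E] {f : M → E} (hf : ContMDiff (𝓡 2) 𝓘(ℝ, E) ∞ f)
    {e : OpenPartialHomeomorph M Plane} (he : e ∈ atlas Plane M) :
    ContDiffOn ℝ ∞ (f ∘ e.symm) e.target :=
  contMDiffOn_iff_contDiffOn.1 (hf.comp_contMDiffOn
    (contMDiffOn_symm_of_mem_maximalAtlas (IsManifold.subset_maximalAtlas he)))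

theorem IsSpacelikeImmersion.localImmersion [IsManifold (𝓡 2) ∞ M] {φ : M → Fin 4 → ℝ}
    (hφ : IsSpacelikeImmersion φ) {e : OpenPartialHomeomorph M Plane} (he : e ∈ atlas Plane M) :
    LocalImmersion (chartTarget e) (φ ∘ e.symm) :=
  ⟨contDiffOn_comp_chart_symm hφ.smooth he, fun _ _ => hφ.mem_adS _, fun x hx v hv => by
    rw [fderiv_comp_chart_symm hφ.smooth he hx]
    exact hφ.spacelike _ _ (mfderiv_chart_symm_ne_zero he hx hv)⟩

theorem ip_center {u τ : Fin 4 → ℝ} (hu : ip u u = -1) (huτ : ip τ u = 0) (hτ : ip τ τ = -4) :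
    ip (u - (1 / 2 : ℝ) • τ) (u - (1 / 2 : ℝ) • τ) = -2 ∧ ip (u - (1 / 2 : ℝ) • τ) u = -1 := by
  simp only [ip, Pi.sub_apply, Pi.smul_apply, smul_eq_mul] at *
  constructor
  · linear_combination hu - huτ + (1 / 4) * hτ
  · linear_combination hu - (1 / 2) * huτ

/-- A proper biharmonic surface lies at a constant distance from a point `c` of `R⁴₂`: the centre of
the umbilical part is the same at nearby points, and the umbilical part is closed because a
maximal surface does not contain an open piece with such a centre. -/
theorem exists_center [ConnectedSpace M] [IsManifold (𝓡 2) ∞ M] {φ : M → Fin 4 → ℝ}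
    (hφ : IsSpacelikeImmersion φ) (hbi : IsBiharmonic φ) (hproper : ¬ IsMaximal φ) :
    ∃ c : Fin 4 → ℝ, ip c c = -2 ∧ ∀ p, ip c (φ p) = -1 := by
  -- the centre exists near any point of a chart where the alternative of maximality fails
  have local_center : ∀ (e : OpenPartialHomeomorph M Plane), e ∈ atlas Plane M → ∀ x ∈ e.target,
      ∀ c, (∀ᶠ y in 𝓝 x, (φ ∘ e.symm) y - (1 / 2 : ℝ) • tension (φ ∘ e.symm) y = c ∧
        ip (tension (φ ∘ e.symm) y) (tension (φ ∘ e.symm) y) = -4) →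
      ip c c = -2 ∧ ∀ᶠ q in 𝓝 (e.symm x), ip c (φ q) = -1 := by
    intro e he x hx c hc
    have hL := hφ.localImmersion he
    have hev : ∀ᶠ y in 𝓝 x, ip c c = -2 ∧ ip c ((φ ∘ e.symm) y) = -1 := by
      filter_upwards [hc, e.open_target.mem_nhds hx] with y hy hyt
      rw [← hy.1]
      exact ip_center (hL.mem_adS y hyt) (hL.tension_ip_self hyt) hy.2
    refine ⟨hev.self_of_nhds.1, ?_⟩
    have hxs := e.map_target hx
    have hcont : Tendsto e (𝓝 (e.symm x)) (𝓝 x) := by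
      have := e.continuousAt hxs
      rwa [ContinuousAt, e.right_inv hx] at this
    filter_upwards [hcont.eventually hev, e.open_source.mem_nhds hxs] with q hq hqs
    have := hq.2
    rwa [Function.comp_apply, e.left_inv hqs] at this
  obtain ⟨e, he, x, hx, hτ⟩ : ∃ e ∈ atlas Plane M, ∃ x ∈ e.target,
      tension (φ ∘ e.symm) x ≠ 0 := by
    simpa [IsMaximal] using hproper
  obtain ⟨c, hc⟩ := ((hφ.localImmersion he).maximal_or_umbilical (hbi e he) hx).resolve_left
    (fun h => hτ h.self_of_nhds)
  obtain ⟨hcc, hxc⟩ := local_center e he x hx c hc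
  refine ⟨c, hcc, ?_⟩
  let G : Set M := {p | ∀ᶠ q in 𝓝 p, ip c (φ q) = -1}
  have hG : IsClopen G := by
    refine ⟨isClosed_of_closure_subset fun p hp => ?_, isOpen_iff_mem_nhds.2 fun p hp => ?_⟩
    · have he' := chart_mem_atlas Plane p
      have hps := mem_chart_source Plane p
      set e' := chartAt Plane p with he'def
      have hL := hφ.localImmersion he'
      have hpt := e'.map_source hps
      -- near `p` there are points of `G`, whose images in the chart have the centre `c`
      have hnear : ∀ P : Plane → Prop, (∀ᶠ y in 𝓝 (e' p), P y) → ∃ y ∈ e'.target, P y ∧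
          ∀ᶠ z in 𝓝 y, ip c ((φ ∘ e'.symm) z) = -1 := by
        intro P hP
        have h1 : ∀ᶠ q in 𝓝 p, P (e' q) ∧ q ∈ e'.source :=
          ((e'.continuousAt hps).eventually hP).and (e'.open_source.mem_nhds hps)
        obtain ⟨q, ⟨hqP, hqs⟩, hqG⟩ := mem_closure_iff_nhds.1 hp _ h1
        have hqt := e'.map_source hqs
        refine ⟨e' q, hqt, hqP, ?_⟩
        have hcont := e'.continuousAt_symm hqt
        rw [ContinuousAt, e'.left_inv hqs] at hcont
        exact hcont.eventually hqG
      rcases hL.maximal_or_umbilical (hbi e' he') hpt with h | ⟨c', h⟩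
      · obtain ⟨y, hyt, hy0, hyc⟩ := hnear _ h
        have := (hL.ip_tension_of_const hyt hyc).2
        rw [hy0] at this
        simp [ip] at this
      · obtain ⟨y, hyt, hy0, hyc⟩ := hnear _ h
        have hcc' : c' = c := by
          rw [← hy0.1]
          exact hL.eq_center hcc hyt hyc hy0.2
        have := (local_center e' he' (e' p) hpt c' h).2
        rwa [e'.left_inv hps, hcc'] at this
    · exact hp.eventually_nhds
  have huniv := hG.eq_univ ⟨e.symm x, hxc⟩
  intro p
  have hp : p ∈ G := huniv ▸ mem_univ p
  exact hp.self_of_nhds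

end Center

/-! ### Isometries of `R⁴₂` -/

section Isometries

/-- The reflection in the hyperplane orthogonal to `n`. -/
def reflection (n : Fin 4 → ℝ) : (Fin 4 → ℝ) →ₗ[ℝ] (Fin 4 → ℝ) where
  toFun x := x - (2 * ip x n / ip n n) • n
  map_add' x y := by rw [ip_add_left]; module
  map_smul' r x := by rw [ip_smul_left, RingHom.id_apply]; module

theorem reflection_apply (n x : Fin 4 → ℝ) :
    reflection n x = x - (2 * ip x n / ip n n) • n := rfl

theorem ip_sub_smul (x n : Fin 4 → ℝ) (r t : ℝ) (y : Fin 4 → ℝ) :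
    ip (x - r • n) (y - t • n) = ip x y - t * ip x n - r * ip y n + r * t * ip n n := by
  simp only [ip, Pi.sub_apply, Pi.smul_apply, smul_eq_mul]; ring

theorem ip_reflection {n : Fin 4 → ℝ} (hn : ip n n ≠ 0) (x y : Fin 4 → ℝ) :
    ip (reflection n x) (reflection n y) = ip x y := by
  rw [reflection_apply, reflection_apply, ip_sub_smul]
  field_simp
  ring

theorem reflection_involutive {n : Fin 4 → ℝ} (hn : ip n n ≠ 0) :
    Function.Involutive (reflection n) := by
  intro x
  rw [reflection_apply, reflection_apply, ip_sub_left, ip_smul_left]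
  have : 2 * (ip x n - 2 * ip x n / ip n n * ip n n) / ip n n = -(2 * ip x n / ip n n) := by
    field_simp
    ring
  rw [this]
  module

/-- Isometries act transitively on the vectors of a given nonzero length: the reflections in `v - w`
and in `v + w` map `v` to `w` and to `-w`, and one of these two vectors is not null. -/
theorem exists_isometry {v w : Fin 4 → ℝ} (h : ip v v = ip w w) (hv : ip v v ≠ 0) :
    ∃ T : (Fin 4 → ℝ) ≃ₗ[ℝ] (Fin 4 → ℝ), (∀ x y, ip (T x) (T y) = ip x y) ∧ T v = w := by
  by_cases h0 : ip (v - w) (v - w) = 0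
  · have h1 : ip (v + w) (v + w) ≠ 0 := by
      intro h1
      apply hv
      simp only [ip, Pi.sub_apply, Pi.add_apply] at *
      linarith
    refine ⟨(LinearEquiv.ofInvolutive _ (reflection_involutive h1)).trans (LinearEquiv.neg ℝ),
      fun x y => ?_, ?_⟩
    · rw [← ip_reflection h1 x y]
      simp [ip]
    · have : 2 * ip v (v + w) / ip (v + w) (v + w) = 1 := by
        rw [div_eq_one_iff_eq h1]
        simp only [ip, Pi.add_apply] at *
        linear_combination h
      change -(v - (2 * ip v (v + w) / ip (v + w) (v + w)) • (v + w)) = w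
      rw [this]
      module
  · refine ⟨LinearEquiv.ofInvolutive _ (reflection_involutive h0), ip_reflection h0, ?_⟩
    have : 2 * ip v (v - w) / ip (v - w) (v - w) = 1 := by
      rw [div_eq_one_iff_eq h0]
      simp only [ip, Pi.sub_apply] at *
      linear_combination h
    change v - (2 * ip v (v - w) / ip (v - w) (v - w)) • (v - w) = w
    rw [this]
    module

/-- A connected set of points of anti-de Sitter space at constant distance from a centre can be
moved to the upper half of the slice `x₄ = 1 / √2`. -/
theorem exists_normal_form {M : Type*} [TopologicalSpace M] [PreconnectedSpace M]
    {φ : M → Fin 4 → ℝ} (hφ : Continuous φ) (hmem : ∀ p, φ p ∈ adS) {c : Fin 4 → ℝ}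
    (hcc : ip c c = -2) (hc : ∀ p, ip c (φ p) = -1) :
    ∃ T : (Fin 4 → ℝ) ≃ₗ[ℝ] (Fin 4 → ℝ), (∀ x y, ip (T x) (T y) = ip x y) ∧
      ∀ p, 0 < T (φ p) 2 ∧ T (φ p) 3 = 1 / √2 := by
  have hs : √2 * √2 = 2 := Real.mul_self_sqrt (by norm_num)
  have hs0 : √2 ≠ 0 := by positivity
  obtain ⟨T, hT, hTc⟩ := exists_isometry (v := c) (w := ![0, 0, 0, √2])
    (by rw [hcc]; simp [ip]) (by rw [hcc]; norm_num)
  have h3 : ∀ p, T (φ p) 3 = 1 / √2 := by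
    intro p
    have h := hc p
    rw [← hT, hTc] at h
    simp [ip] at h
    rw [eq_div_iff hs0]
    linarith
  -- the third coordinate has no zero, hence a constant sign, which a reflection makes positive
  have h2 : ∀ p, T (φ p) 2 ≠ 0 := by
    intro p h
    have h1 : ip (T (φ p)) (T (φ p)) = -1 := (hT _ _).trans (hmem p)
    have h4 : (1 / √2) * (1 / √2) = 1 / 2 := by rw [div_mul_div_comm, hs]; norm_num
    rw [ip, h3, h, h4] at h1
    nlinarith [mul_self_nonneg (T (φ p) 0), mul_self_nonneg (T (φ p) 1)]
  have hcont : Continuous fun p => T (φ p) 2 :=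
    (continuous_apply 2).comp
      ((LinearMap.continuous_of_finiteDimensional T.toLinearMap).comp hφ)
  by_cases hpos : ∀ p, 0 < T (φ p) 2
  · exact ⟨T, hT, fun p => ⟨hpos p, h3 p⟩⟩
  · push Not at hpos
    obtain ⟨p₀, hp₀⟩ := hpos
    have hneg : ∀ p, T (φ p) 2 < 0 := by
      intro p
      by_contra! h
      obtain ⟨q, hq⟩ := mem_range_of_exists_le_of_exists_ge hcont ⟨p₀, hp₀⟩ ⟨p, h⟩
      exact h2 q hq
    have hn : ip ![0, 0, 1, 0] ![0, 0, 1, 0] ≠ 0 := by simp [ip]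
    refine ⟨T.trans (LinearEquiv.ofInvolutive _ (reflection_involutive hn)), fun x y => ?_,
      fun p => ?_⟩
    · exact (ip_reflection hn _ _).trans (hT x y)
    · have e : ∀ y : Fin 4 → ℝ, reflection ![0, 0, 1, 0] y 2 = -y 2 ∧
          reflection ![0, 0, 1, 0] y 3 = y 3 := by
        intro y
        constructor
        · simp [reflection_apply, ip]; ring
        · simp [reflection_apply]
      exact ⟨(neg_pos.2 (hneg p)).trans_eq (e _).1.symm, (e _).2.trans (h3 p)⟩

end Isometries

/-! ### Local diffeomorphisms to the plane that do not decrease the length -/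

section LocalDiffeo

variable {M : Type*} [TopologicalSpace M] [ChartedSpace (EuclideanSpace ℝ (Fin 2)) M]

/-- The inverse function theorem on a surface. -/
theorem isLocalDiffeomorph_of_mfderiv_ne_zero [IsManifold (𝓡 2) ∞ M] {P : M → Plane}
    (hP : ContMDiff (𝓡 2) (𝓡 2) ∞ P)
    (hinj : ∀ (p : M) (v : TangentSpace (𝓡 2) p), v ≠ 0 → mfderiv (𝓡 2) (𝓡 2) P p v ≠ 0) :
    IsLocalDiffeomorph (𝓡 2) (𝓡 2) ∞ P := by
  intro p
  have he := chart_mem_atlas Plane p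
  have hps := mem_chart_source Plane p
  set e := chartAt Plane p with he_def
  have hpt := e.map_source hps
  set g : Plane → Plane := P ∘ e.symm with hg_def
  have hg := contDiffOn_comp_chart_symm hP he
  have hgx : ∀ x ∈ e.target, ContDiffAt ℝ ∞ g x :=
    fun x hx => hg.contDiffAt (e.open_target.mem_nhds hx)
  have hder : ∀ x ∈ e.target, ∃ L : Plane ≃L[ℝ] Plane,
      HasFDerivAt g (L : Plane →L[ℝ] Plane) x := by
    intro x hx
    have hinj' : Function.Injective (fderiv ℝ g x : Plane →ₗ[ℝ] Plane) := by
      refine (injective_iff_map_eq_zero _).2 fun v hv => ?_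
      by_contra hv0
      refine hinj _ _ (mfderiv_chart_symm_ne_zero he hx hv0) ?_
      exact (fderiv_comp_chart_symm hP he hx v).symm.trans hv
    refine ⟨(LinearEquiv.ofInjectiveEndo _ hinj').toContinuousLinearEquiv, ?_⟩
    have h : ((LinearEquiv.ofInjectiveEndo _ hinj').toContinuousLinearEquiv : Plane →L[ℝ] Plane) =
      fderiv ℝ g x := by ext1 v; rfl
    rw [h]
    exact ((hgx x hx).differentiableAt (by simp)).hasFDerivAt
  obtain ⟨L, hL⟩ := hder (e p) hpt
  let Φ := (hgx (e p) hpt).toOpenPartialHomeomorph g hL (by simp)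
  let Ψ : OpenPartialHomeomorph M Plane := e.trans Φ
  have hΨP : EqOn P Ψ Ψ.source := fun q hq => by
    have hqs : q ∈ e.source := by
      rw [OpenPartialHomeomorph.trans_source] at hq; exact hq.1
    change P q = P (e.symm (e q))
    rw [e.left_inv hqs]
  refine ⟨⟨Ψ.toPartialEquiv, Ψ.open_source, Ψ.open_target, hP.contMDiffOn.congr
    fun q hq => (hΨP hq).symm, fun y hy => ?_⟩, ?_, hΨP⟩
  · have hy' : y ∈ Φ.target ∧ Φ.symm y ∈ e.target := by
      have : y ∈ Ψ.target := hy
      rw [OpenPartialHomeomorph.trans_target] at this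
      exact this
    obtain ⟨L', hL'⟩ := hder _ hy'.2
    have h1 : ContDiffAt ℝ ∞ Φ.symm y := Φ.contDiffAt_symm hy'.1 hL' (hgx _ hy'.2)
    have h2 : ContMDiffAt (𝓡 2) (𝓡 2) ∞ e.symm (Φ.symm y) :=
      (contMDiffOn_symm_of_mem_maximalAtlas (IsManifold.subset_maximalAtlas he)).contMDiffAt
        (e.open_target.mem_nhds hy'.2)
    exact (h2.comp y h1.contMDiffAt).contMDiffWithinAt
  · change p ∈ Ψ.source
    rw [OpenPartialHomeomorph.trans_source]
    exact ⟨hps, (hgx (e p) hpt).mem_toOpenPartialHomeomorph_source hL (by simp)⟩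

/-- A continuous lift of a smooth curve through a local diffeomorphism is smooth. -/
theorem contMDiffOn_of_lift {P : M → Plane} (hP : IsLocalDiffeomorph (𝓡 2) (𝓡 2) ∞ P)
    {γ : ℝ → M} {ρ : ℝ → Plane} {s : Set ℝ} (hγ : ContinuousOn γ s) (hρ : ContDiff ℝ ∞ ρ)
    (h : ∀ t ∈ s, P (γ t) = ρ t) : ContMDiffOn 𝓘(ℝ) (𝓡 2) ∞ γ s := by
  intro t ht
  obtain ⟨Φ, hΦ, hPΦ⟩ := hP (γ t)
  have hPt : Φ (γ t) = ρ t := by rw [← hPΦ hΦ, h t ht]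
  have hsymm : ContMDiffAt (𝓡 2) (𝓡 2) ∞ Φ.invFun (ρ t) :=
    Φ.contMDiffOn_invFun.contMDiffAt (Φ.open_target.mem_nhds (hPt ▸ Φ.map_source hΦ))
  have h1 : ContMDiffWithinAt 𝓘(ℝ) (𝓡 2) ∞ (Φ.invFun ∘ ρ) s t :=
    (hsymm.comp t hρ.contMDiff.contMDiffAt).contMDiffWithinAt
  have h2 : ∀ t' ∈ s, γ t' ∈ Φ.source → γ t' = (Φ.invFun ∘ ρ) t' := by
    intro t' ht' hs
    rw [Function.comp_apply, ← h t' ht', hPΦ hs]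
    exact (Φ.left_inv hs).symm
  refine h1.congr_of_eventuallyEq ?_ (h2 t ht hΦ)
  filter_upwards [hγ t ht (Φ.open_source.mem_nhds hΦ), self_mem_nhdsWithin] with t' ht' hs
  exact h2 t' hs ht'

/-- The map `P` to the Euclidean plane does not decrease the length, in the metric induced by `φ`,
of any tangent vector. -/
def IsLengthNondecreasing (φ : M → Fin 4 → ℝ) (P : M → Plane) : Prop :=
  ∀ (p : M) (v : TangentSpace (𝓡 2) p),
    ip (mfderiv (𝓡 2) 𝓘(ℝ, Fin 4 → ℝ) φ p v) (mfderiv (𝓡 2) 𝓘(ℝ, Fin 4 → ℝ) φ p v) ≤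
      @norm Plane _ (mfderiv (𝓡 2) (𝓡 2) P p v) ^ 2

variable {φ : M → Fin 4 → ℝ}

theorem enormSMulClass_inducedENorm (p : M) :
    letI := inducedENorm φ p
    ENormSMulClass ℝ (TangentSpace (𝓡 2) p) := by
  let := inducedENorm φ p
  refine ⟨fun r v => ?_⟩
  have key : ∀ y : Fin 4 → ℝ,
      ENNReal.ofReal √(ip (r • y) (r • y)) = ‖r‖ₑ * ENNReal.ofReal √(ip y y) := fun y => by
    rw [ip_smul_left, ip_comm, ip_smul_left, ← mul_assoc, Real.sqrt_mul (mul_self_nonneg r),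
      Real.sqrt_mul_self_eq_abs, ENNReal.ofReal_mul (abs_nonneg r), ← Real.norm_eq_abs,
      ofReal_norm]
  change ENNReal.ofReal (√(ip (mfderiv (𝓡 2) 𝓘(ℝ, Fin 4 → ℝ) φ p (r • v))
    (mfderiv (𝓡 2) 𝓘(ℝ, Fin 4 → ℝ) φ p (r • v)))) = ‖r‖ₑ * ENNReal.ofReal _
  rw [map_smul]
  exact key _

theorem inducedEDist_comm (p q : M) : inducedEDist φ p q = inducedEDist φ q p := by
  let : ∀ p : M, ENorm (TangentSpace (𝓡 2) p) := inducedENorm φ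
  have := enormSMulClass_inducedENorm (φ := φ)
  exact Manifold.riemannianEDist_comm

/-- The lift of a straight segment is at most as long as the segment. -/
theorem inducedEDist_le_of_lift {P : M → Plane}
    (hP : IsLocalDiffeomorph (𝓡 2) (𝓡 2) ∞ P)
    (hle : IsLengthNondecreasing φ P)
    {γ : ℝ → M} {z w : Plane} {a b : ℝ} (hab : a ≤ b) (hγ : ContinuousOn γ (Icc a b))
    (h : ∀ t ∈ Icc a b, P (γ t) = z + t • w) :
    inducedEDist φ (γ a) (γ b) ≤ ENNReal.ofReal (‖w‖ * (b - a)) := by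
  let : ∀ p : M, ENorm (TangentSpace (𝓡 2) p) := inducedENorm φ
  have := enormSMulClass_inducedENorm (φ := φ)
  have hsm := contMDiffOn_of_lift hP hγ (ρ := fun t => z + t • w) (by fun_prop) h
  have h1 : riemannianEDist (𝓡 2) (γ a) (γ b) ≤ Manifold.pathELength (𝓡 2) γ a b :=
    riemannianEDist_le_pathELength (hsm.of_le (by norm_cast)) rfl rfl hab
  refine h1.trans ?_
  rcases hab.eq_or_lt with rfl | hlt
  · simp
  rw [Manifold.pathELength_eq_lintegral_mfderivWithin_Icc]
  have h2 : ∀ t ∈ Icc a b, ‖mfderivWithin 𝓘(ℝ) (𝓡 2) γ (Icc a b) t 1‖ₑ ≤ ENNReal.ofReal ‖w‖ := by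
    intro t ht
    have hu : UniqueMDiffWithinAt 𝓘(ℝ) (Icc a b) t :=
      (uniqueDiffOn_Icc hlt).uniqueMDiffOn t ht
    have e1 := mfderiv_comp_mfderivWithin t (hP.mdifferentiable (by simp) (γ t))
      (hsm.mdifferentiableOn (by simp) t ht) hu
    have e2 : mfderivWithin 𝓘(ℝ) (𝓡 2) (P ∘ γ) (Icc a b) t =
        fderivWithin ℝ (fun t : ℝ => z + t • w) (Icc a b) t := by
      rw [← mfderivWithin_eq_fderivWithin]
      exact mfderivWithin_congr h (h t ht)
    have e3 : fderivWithin ℝ (fun t : ℝ => z + t • w) (Icc a b) t 1 = w := by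
      have hd : HasDerivAt (fun t : ℝ => z + t • w) ((1 : ℝ) • w) t :=
        ((hasDerivAt_id t).smul_const w).const_add z
      rw [fderivWithin_derivWithin, hd.hasDerivWithinAt.derivWithin (uniqueDiffOn_Icc hlt t ht),
        one_smul]
    have e4 : mfderiv (𝓡 2) (𝓡 2) P (γ t) (mfderivWithin 𝓘(ℝ) (𝓡 2) γ (Icc a b) t 1) = w := by
      refine Eq.trans ?_ e3
      rw [← e2, e1]
      rfl
    refine ENNReal.ofReal_le_ofReal (Real.sqrt_le_iff.2 ⟨norm_nonneg w, ?_⟩)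
    refine (hle _ _).trans_eq ?_
    rw [e4]
  calc _ ≤ ∫⁻ _ in Icc a b, ENNReal.ofReal ‖w‖ :=
        MeasureTheory.setLIntegral_mono measurable_const h2
    _ = _ := by
        rw [MeasureTheory.setLIntegral_const, Real.volume_Icc, ENNReal.ofReal_mul (norm_nonneg w)]

/-- On a complete surface, segments can be lifted through a local diffeomorphism to the plane that
does not decrease the length of tangent vectors. -/
theorem exists_lift_segment [T2Space M] {P : M → Plane}
    (hP : IsLocalDiffeomorph (𝓡 2) (𝓡 2) ∞ P)
    (hle : IsLengthNondecreasing φ P)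
    (hc : IsCompleteSurface φ) (p₀ : M) (w : Plane) :
    ∃ γ : ℝ → M, ContinuousOn γ (Icc 0 1) ∧ γ 0 = p₀ ∧ ∀ t ∈ Icc (0 : ℝ) 1,
      P (γ t) = P p₀ + t • w := by
  have hloc := hP.isLocalHomeomorph
  have hsep : IsSeparatedMap P := T2Space.isSeparatedMap P
  have hPc : Continuous P := hloc.continuous
  let IsLift (T : ℝ) (γ : ℝ → M) : Prop :=
    ContinuousOn γ (Icc 0 T) ∧ γ 0 = p₀ ∧ ∀ t ∈ Icc (0 : ℝ) T, P (γ t) = P p₀ + t • w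
  have hmono : ∀ {T T' γ}, T' ≤ T → IsLift T γ → IsLift T' γ := fun h hγ =>
    ⟨hγ.1.mono (Icc_subset_Icc_right h), hγ.2.1, fun t ht => hγ.2.2 t ⟨ht.1, ht.2.trans h⟩⟩
  have huniq : ∀ {T γ γ'}, 0 ≤ T → IsLift T γ → IsLift T γ' → γ T = γ' T := by
    intro T γ γ' hT hγ hγ'
    exact hsep.eqOn_of_comp_eqOn hloc.isLocallyInjective isPreconnected_Icc hγ.1 hγ'.1
      (fun t ht => (hγ.2.2 t ht).trans (hγ'.2.2 t ht).symm) (left_mem_Icc.2 hT)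
      (hγ.2.1.trans hγ'.2.1.symm) (right_mem_Icc.2 hT)
  let S : Set ℝ := {T | 0 ≤ T ∧ T ≤ 1 ∧ ∃ γ, IsLift T γ}
  have h0S : (0 : ℝ) ∈ S := by
    refine ⟨le_rfl, zero_le_one, fun _ => p₀, continuousOn_const, rfl, fun t ht => ?_⟩
    rw [show t = 0 from le_antisymm ht.2 ht.1]
    simp
  have hbdd : BddAbove S := ⟨1, fun T hT => hT.2.1⟩
  -- a limit of times up to which a lift exists can be passed
  have hext : ∀ T ∈ closure S, ∃ ε > 0, ∀ T', T' < T + ε → ∃ γ, IsLift T' γ := by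
    intro T hT
    obtain ⟨a, haS, haT⟩ := mem_closure_iff_seq_limit.1 hT
    choose γ hγ using fun n => (haS n).2.2
    have hdist : ∀ m n, a m ≤ a n → inducedEDist φ (γ m (a m)) (γ n (a n)) ≤
        ENNReal.ofReal (‖w‖ * (a n - a m)) := by
      intro m n hmn
      rw [huniq (haS m).1 (hγ m) (hmono hmn (hγ n))]
      exact inducedEDist_le_of_lift hP hle hmn
        ((hγ n).1.mono (Icc_subset_Icc_left (haS m).1))
        (fun t ht => (hγ n).2.2 t ⟨(haS m).1.trans ht.1, ht.2⟩)
    have hdist' : ∀ m n, inducedEDist φ (γ m (a m)) (γ n (a n)) ≤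
        ENNReal.ofReal (‖w‖ * |a n - a m|) := by
      intro m n
      rcases le_total (a m) (a n) with h | h
      · rw [abs_of_nonneg (sub_nonneg.2 h)]
        exact hdist m n h
      · rw [inducedEDist_comm, abs_sub_comm, abs_of_nonneg (sub_nonneg.2 h)]
        exact hdist n m h
    obtain ⟨p, hp⟩ := hc (fun n => γ n (a n)) (by
      intro ε hε
      have ht : Tendsto (fun x : ℝ × ℝ => ENNReal.ofReal (‖w‖ * |x.2 - x.1|)) (𝓝 (T, T)) (𝓝 0) := by
        have : Continuous fun x : ℝ × ℝ => ENNReal.ofReal (‖w‖ * |x.2 - x.1|) :=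
          ENNReal.continuous_ofReal.comp (by fun_prop)
        simpa using this.tendsto (T, T)
      have ht2 := (ht.comp
        ((haT.comp tendsto_fst).prodMk_nhds
          (haT.comp (tendsto_snd (f := atTop))))).eventually (gt_mem_nhds hε)
      rw [prod_atTop_atTop_eq, eventually_atTop] at ht2
      obtain ⟨N, hN⟩ := ht2
      refine ⟨max N.1 N.2, fun m hm n hn => (hdist' m n).trans_lt (hN (m, n) ⟨?_, ?_⟩)⟩
      · exact (le_max_left _ _).trans hm
      · exact (le_max_right _ _).trans hn)
    have hPa : ∀ n, P (γ n (a n)) = P p₀ + a n • w :=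
      fun n => (hγ n).2.2 _ (right_mem_Icc.2 (haS n).1)
    have hρ : Continuous fun t : ℝ => P p₀ + t • w := by fun_prop
    have hPp : P p = P p₀ + T • w := by
      refine tendsto_nhds_unique ((hPc.tendsto p).comp hp) ?_
      refine Tendsto.congr (fun n => (hPa n).symm) ((hρ.tendsto T).comp haT)
    obtain ⟨Φ, hpΦ, hPΦ⟩ := hloc p
    have htarget : ∀ᶠ t in 𝓝 T, P p₀ + t • w ∈ Φ.target := by
      refine hρ.continuousAt.eventually (Φ.open_target.mem_nhds ?_)
      change P p₀ + T • w ∈ Φ.target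
      rw [← hPp, hPΦ]
      exact Φ.map_source hpΦ
    obtain ⟨ε, hε, hball⟩ := Metric.eventually_nhds_iff.1 htarget
    obtain ⟨n, hn1, hn2⟩ := ((hp.eventually (Φ.open_source.mem_nhds hpΦ)).and
      (haT.eventually (Metric.ball_mem_nhds T hε))).exists
    have hn3 := abs_lt.1 (Real.dist_eq _ _ ▸ Metric.mem_ball.1 hn2)
    refine ⟨ε, hε, fun T' hT' => ?_⟩
    rcases le_total T' (a n) with hle' | hle'
    · exact ⟨γ n, hmono hle' (hγ n)⟩
    have hin : ∀ t ∈ Icc (a n) T', P p₀ + t • w ∈ Φ.target := fun t ht =>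
      hball (by rw [Real.dist_eq, abs_lt]; constructor <;> linarith [ht.1, ht.2])
    have hjoin : Φ.symm (P p₀ + a n • w) = γ n (a n) := by
      rw [← hPa n, hPΦ]; exact Φ.left_inv hn1
    let η : ℝ → M := fun t => if t ≤ a n then γ n t else Φ.symm (P p₀ + t • w)
    have hη1 : EqOn η (γ n) (Icc 0 (a n)) := fun t ht => if_pos ht.2
    have hη2 : EqOn η (fun t => Φ.symm (P p₀ + t • w)) (Icc (a n) T') := by
      intro t ht
      by_cases h : t ≤ a n
      · rw [le_antisymm h ht.1]
        exact (if_pos le_rfl).trans hjoin.symm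
      · exact if_neg h
    refine ⟨η, ?_, ?_, fun t ht => ?_⟩
    · rw [← Icc_union_Icc_eq_Icc (haS n).1 hle']
      refine ContinuousOn.union_of_isClosed ((hγ n).1.congr hη1) (ContinuousOn.congr ?_ hη2)
        isClosed_Icc isClosed_Icc
      exact Φ.continuousOn_symm.comp hρ.continuousOn hin
    · rw [hη1 (left_mem_Icc.2 (haS n).1)]
      exact (hγ n).2.1
    · rcases le_total t (a n) with h | h
      · rw [hη1 ⟨ht.1, h⟩]
        exact (hγ n).2.2 t ⟨ht.1, h⟩
      · rw [hη2 ⟨h, ht.2⟩]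
        exact (congrFun hPΦ _).trans <| Φ.right_inv (hin t ⟨h, ht.2⟩)
  have hsup := csSup_mem_closure ⟨0, h0S⟩ hbdd
  have hsup0 : 0 ≤ sSup S := le_csSup hbdd h0S
  obtain ⟨ε, hε, hlift⟩ := hext _ hsup
  by_cases h1 : 1 < sSup S + ε
  · exact hlift 1 h1
  · exfalso
    have hmem : sSup S + ε / 2 ∈ S :=
      ⟨by linarith, by linarith, hlift _ (by linarith)⟩
    linarith [le_csSup hbdd hmem]

/-- On a complete surface, a local diffeomorphism to the plane that does not decrease the length of
tangent vectors has a continuous section, formed by the end points of the lifts of segments. On a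
connected Hausdorff surface, such a section is a two-sided inverse. -/
theorem bijective_of_complete [T2Space M] [ConnectedSpace M] {P : M → Plane}
    (hP : IsLocalDiffeomorph (𝓡 2) (𝓡 2) ∞ P)
    (hle : IsLengthNondecreasing φ P)
    (hc : IsCompleteSurface φ) : Function.Bijective P := by
  have hloc := hP.isLocalHomeomorph
  have hsep : IsSeparatedMap P := T2Space.isSeparatedMap P
  obtain ⟨p₀⟩ : Nonempty M := inferInstance
  choose γ hγc hγ0 hγ using fun z : Plane => exists_lift_segment hP hle hc p₀ (z - P p₀)
  -- the lifts of the segments that start at `P p₀` form a continuous section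
  let f : C(unitInterval × Plane, Plane) :=
    ⟨fun x => P p₀ + (x.1 : ℝ) • (x.2 - P p₀), by fun_prop⟩
  have hcont : Continuous fun x : unitInterval × Plane => γ x.2 x.1 := by
    refine hloc.continuous_lift hsep f (funext fun x => hγ x.2 x.1 x.1.2) ?_ fun z => ?_
    · simpa [hγ0] using continuous_const
    · exact (hγc z).comp_continuous continuous_subtype_val fun t => t.2
  let σ : Plane → M := fun z => γ z 1
  have hσ : Continuous σ := hcont.comp (Continuous.prodMk_right (1 : unitInterval))
  have hPσ : ∀ z, P (σ z) = z := by
    intro z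
    have := hγ z 1 (right_mem_Icc.2 zero_le_one)
    simpa using this
  have hσP : σ ∘ P = id :=
    hsep.eq_of_comp_eq hloc.isLocallyInjective (hσ.comp hloc.continuous) continuous_id
      (funext fun p => hPσ (P p)) (σ 0) (congrArg σ (hPσ 0))
  exact ⟨Function.LeftInverse.injective (congrFun hσP), Function.RightInverse.surjective hPσ⟩

end LocalDiffeo

/-! ### The projection of the hyperbolic plane to its first two coordinates -/

/-- The linear projection of `R⁴₂` to the Euclidean plane of the first two coordinates. -/
def proj : (Fin 4 → ℝ) →L[ℝ] Plane :=
  LinearMap.toContinuousLinearMap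
    { toFun := fun x => !₂[x 0, x 1]
      map_add' := fun x y => by ext i; fin_cases i <;> simp
      map_smul' := fun c x => by ext i; fin_cases i <;> simp }

theorem ip_self_le_norm_proj_sq (x : Fin 4 → ℝ) : ip x x ≤ ‖proj x‖ ^ 2 := by
  have h : ‖proj x‖ ^ 2 = x 0 ^ 2 + x 1 ^ 2 := by
    simp [proj, EuclideanSpace.norm_sq_eq, Fin.sum_univ_two]
  rw [h, ip]
  nlinarith [mul_self_nonneg (x 2), mul_self_nonneg (x 3)]

/-- The hyperbolic plane is a graph over the plane of the first two coordinates. -/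
def hyperbolicPlaneHomeomorph {r : ℝ} (hr : r ≠ 0) : hyperbolicPlane r ≃ₜ Plane where
  toFun y := !₂[y.1 0, y.1 1]
  invFun z := ⟨![z 0, z 1, √(r ^ 2 + z 0 ^ 2 + z 1 ^ 2)], by
    have h : 0 < r ^ 2 + z 0 ^ 2 + z 1 ^ 2 := by positivity
    refine ⟨?_, Real.sqrt_pos.2 h⟩
    simp only [Matrix.cons_val]
    rw [Real.sq_sqrt h.le]
    ring⟩
  left_inv := by
    rintro ⟨y, hy, hy0⟩
    have h : √(r ^ 2 + y 0 ^ 2 + y 1 ^ 2) = y 2 := by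
      rw [show r ^ 2 + y 0 ^ 2 + y 1 ^ 2 = y 2 ^ 2 by linarith, Real.sqrt_sq hy0.le]
    ext i
    fin_cases i <;> simp [h]
  right_inv z := by ext i; fin_cases i <;> simp
  continuous_toFun := by
    refine (PiLp.continuous_toLp 2 _).comp (continuous_pi fun i => ?_)
    have h (j : Fin 3) : Continuous fun y : hyperbolicPlane r => y.1 j :=
      (continuous_apply j).comp continuous_subtype_val
    fin_cases i
    exacts [h 0, h 1]
  continuous_invFun := by
    refine Continuous.subtype_mk (continuous_pi fun i => ?_) _
    fin_cases i <;> simp <;> fun_prop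

section Projection

variable {M : Type*} [TopologicalSpace M] [ChartedSpace (EuclideanSpace ℝ (Fin 2)) M]
  {φ : M → Fin 4 → ℝ} {T : (Fin 4 → ℝ) ≃ₗ[ℝ] (Fin 4 → ℝ)}

theorem contMDiff_proj_comp (hφ : ContMDiff (𝓡 2) 𝓘(ℝ, Fin 4 → ℝ) ∞ φ) :
    ContMDiff (𝓡 2) (𝓡 2) ∞ fun p => proj (T (φ p)) :=
  (proj.comp T.toContinuousLinearEquiv.toContinuousLinearMap).contDiff.contMDiff.comp hφ

theorem mfderiv_proj_comp (hφ : ContMDiff (𝓡 2) 𝓘(ℝ, Fin 4 → ℝ) ∞ φ) (p : M)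
    (v : TangentSpace (𝓡 2) p) :
    mfderiv (𝓡 2) (𝓡 2) (fun p => proj (T (φ p))) p v =
      proj (T (mfderiv (𝓡 2) 𝓘(ℝ, Fin 4 → ℝ) φ p v)) := by
  let L := proj.comp T.toContinuousLinearEquiv.toContinuousLinearMap
  have h := mfderiv_comp p (L.contDiff.contMDiff.mdifferentiable (n := ∞) (by simp) (φ p))
    (hφ.mdifferentiable (by simp) p)
  have h2 : mfderiv 𝓘(ℝ, Fin 4 → ℝ) (𝓡 2) L (φ p) = L := by
    rw [mfderiv_eq_fderiv]; exact L.fderiv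
  rw [h2] at h
  exact congrArg (fun A : TangentSpace (𝓡 2) p →L[ℝ] Plane => A v) h

theorem isLengthNondecreasing_proj_comp (hφ : ContMDiff (𝓡 2) 𝓘(ℝ, Fin 4 → ℝ) ∞ φ)
    (hT : ∀ x y, ip (T x) (T y) = ip x y) :
    IsLengthNondecreasing φ fun p => proj (T (φ p)) := by
  intro p v
  rw [mfderiv_proj_comp hφ]
  exact (hT _ _).symm.trans_le (ip_self_le_norm_proj_sq _)

theorem isLocalDiffeomorph_proj_comp [IsManifold (𝓡 2) ∞ M] (hφ : IsSpacelikeImmersion φ)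
    (hT : ∀ x y, ip (T x) (T y) = ip x y) :
    IsLocalDiffeomorph (𝓡 2) (𝓡 2) ∞ fun p => proj (T (φ p)) := by
  refine isLocalDiffeomorph_of_mfderiv_ne_zero (contMDiff_proj_comp hφ.smooth) fun p v hv h0 => ?_
  have h1 := isLengthNondecreasing_proj_comp hφ.smooth hT p v
  rw [h0] at h1
  have h2 : @norm Plane _ 0 ^ 2 = 0 := by simp
  exact absurd ((hφ.spacelike p v hv).trans_le (h1.trans_eq h2)) (lt_irrefl _)

end Projection

end AntiDeSitter

end

theorem theorem1p2 {M : Type*} [TopologicalSpace M] [T2Space M] [ConnectedSpace M]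
    [ChartedSpace (EuclideanSpace ℝ (Fin 2)) M] [IsManifold (𝓡 2) ∞ M]
    (φ : M → Fin 4 → ℝ) (hφ : IsSpacelikeImmersion φ)
    (hbi : IsBiharmonic φ) (hproper : ¬ IsMaximal φ) :
    ∃ T : (Fin 4 → ℝ) ≃ₗ[ℝ] (Fin 4 → ℝ), (∀ x y, ip (T x) (T y) = ip x y) ∧
      ∃ F : M → hyperbolicPlane (1 / √2),
        (∀ p, T (φ p) = slice (1 / √2) (F p)) ∧ IsLocalHomeomorph F ∧
        (IsCompleteSurface φ → IsHomeomorph F) := by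
  obtain ⟨c, hcc, hc⟩ := exists_center hφ hbi hproper
  obtain ⟨T, hT, hTφ⟩ := exists_normal_form hφ.smooth.continuous hφ.mem_adS hcc hc
  have hr : (1 / √2 : ℝ) ^ 2 = 1 / 2 := by
    rw [div_pow, Real.sq_sqrt (by norm_num), one_pow]
  have hF (p : M) : ![T (φ p) 0, T (φ p) 1, T (φ p) 2] ∈ hyperbolicPlane (1 / √2) := by
    have h := (hT (φ p) (φ p)).trans (hφ.mem_adS p)
    rw [ip, (hTφ p).2] at h
    refine ⟨?_, (hTφ p).1⟩
    simp only [Matrix.cons_val]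
    rw [hr]
    linear_combination h + hr
  let F (p : M) : hyperbolicPlane (1 / √2) := ⟨_, hF p⟩
  let G : hyperbolicPlane (1 / √2) ≃ₜ Plane := hyperbolicPlaneHomeomorph (by positivity)
  have hP := isLocalDiffeomorph_proj_comp hφ hT
  have hFP : F = G.symm ∘ fun p => proj (T (φ p)) := by
    funext p
    rw [Function.comp_apply, G.eq_symm_apply]
    rfl
  have hloc : IsLocalHomeomorph F := hFP ▸ G.symm.isLocalHomeomorph.comp hP.isLocalHomeomorph
  refine ⟨T, hT, F, fun p => ?_, hloc, fun hcomplete => ?_⟩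
  · ext i
    fin_cases i
    exacts [rfl, rfl, rfl, (hTφ p).2]
  · have hbij := bijective_of_complete hP (isLengthNondecreasing_proj_comp hφ.smooth hT) hcomplete
    exact ⟨hloc.continuous, hloc.isOpenMap, hFP ▸ G.symm.bijective.comp hbij⟩
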